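/- Let $n\ge 1$ and let $(M^{2n+1},\theta)$ be a compact strictly pseudoconvex pseudohermitian manifold: $M$ carries a CR structure $T^{1,0}M\subset\mathbb C\otimes TM$ of rank $n$ (with $T^{1,0}M\cap\overline{T^{1,0}M}=0$, formally integrable), and $\theta$ is a smooth nowhere vanishing real one-form that annihilates $T^{1,0}M$ and whose Levi form $L_\theta(Z,\overline W)=-i\,d\theta(Z,\overline W)$ is positive definite on $T^{1,0}M$. Integrals over $M$ are taken with respect to the volume form $\theta\wedge(d\theta)^n$. For a smooth function $f\colon M\to\mathbb C$ let $\partial_b f$ and $\bar\partial_b f$ be the restrictions of $df$ to $T^{1,0}M$ and to $T^{0,1}M=\overline{T^{1,0}M}$, let $|\cdot|$ be the norms on $(1,0)$- and $(0,1)$-covectors dual to the Levi form, and let $\Box_b=\bar\partial_b^*\bar\partial_b$ be the Kohn Laplacian, where $\bar\partial_b^*$ is the formal adjoint of $\bar\partial_b$ with respect to these inner products and this volume form. Let $\lambda_k$ ($k\ge1$) be the $k$-th positive eigenvalue of $\Box_b$, counted with multiplicity, $0<\lambda_1\le\lambda_2\le\cdots$, and let $E_k(\theta)$ be the space of smooth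 functions $\psi\colon M\to\mathbb C$ with $\Box_b\psi=\lambda_k\psi$. Suppose that $\psi_1,\dots,\psi_d\in E_k(\theta)$ satisfy, at every point of $M$, $$\sum_{j=1}^d\Big((n+1)\lambda_k|\psi_j|^2-n\,|\bar\partial_b\psi_j|^2\Big)=\lambda_k,$$ and that $$\int_M\Big|\sum_{j=1}^d\bar\psi_j\,\partial_b\psi_j\Big|^2\ \le\ \int_M\Big|\sum_{j=1}^d\bar\psi_j\,\bar\partial_b\psi_j\Big|^2 .$$ Then $\sum_{j=1}^d|\psi_j|^2$ is constant on $M$. -/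

import Mathlib

open scoped Manifold ContDiff TensorProduct Bundle ComplexConjugate

noncomputable section

/-- The model space of manifolds of real dimension `2n+1`. -/
abbrev CRModel (n : ℕ) : Type := EuclideanSpace ℝ (Fin (2 * n + 1))

section ComplexTangent

variable {n : ℕ} {M : Type*} [TopologicalSpace M] [ChartedSpace (CRModel n) M]

variable (n) in
/-- The complexified tangent space `ℂ ⊗ T_x M`. -/
abbrev CTangent (x : M) : Type := ℂ ⊗[ℝ] TangentSpace (𝓡 (2 * n + 1)) x

/-- Complex conjugation on the complexified tangent space, a conjugate-linear map. -/
def conjCT (x : M) : CTangent n x →ₛₗ[starRingEnd ℂ] CTangent n x where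
  toFun Z := LinearMap.rTensor (TangentSpace (𝓡 (2 * n + 1)) x) Complex.conjAe.toLinearMap Z
  map_add' Z W := map_add _ Z W
  map_smul' c Z := by
    induction Z using TensorProduct.induction_on with
    | zero => simp
    | tmul a v => simp [TensorProduct.smul_tmul']
    | add a b ha hb => rw [smul_add, map_add, ha, hb, map_add, smul_add]

theorem conjCT_conjCT (x : M) (Z : CTangent n x) : conjCT x (conjCT x Z) = Z := by
  induction Z using TensorProduct.induction_on with
  | zero => simp
  | tmul a v => simp [conjCT]
  | add a b ha hb => rw [map_add, map_add, ha, hb]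

/-- The complex vector field `X + iY` with real part `X` and imaginary part `Y`. -/
def complexField (X Y : ∀ x : M, TangentSpace (𝓡 (2 * n + 1)) x) (x : M) : CTangent n x :=
  (1 : ℂ) ⊗ₜ[ℝ] X x + Complex.I ⊗ₜ[ℝ] Y x

/-- Smoothness of a real vector field on a set. -/
def SmoothFieldOn [IsManifold (𝓡 (2 * n + 1)) ∞ M] (X : ∀ x : M, TangentSpace (𝓡 (2 * n + 1)) x) (U : Set M) : Prop :=
  ContMDiffOn (𝓡 (2 * n + 1)) (𝓡 (2 * n + 1)).tangent ∞
    (fun x => (⟨x, X x⟩ : TangentBundle (𝓡 (2 * n + 1)) M)) U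

/-- The Lie bracket `[X + iY, X' + iY']`, extended complex bilinearly from real fields. -/
def complexBracket (X Y X' Y' : ∀ x : M, TangentSpace (𝓡 (2 * n + 1)) x) (x : M) :
    CTangent n x :=
  (1 : ℂ) ⊗ₜ[ℝ] (VectorField.mlieBracket (𝓡 (2 * n + 1)) X X' x
      - VectorField.mlieBracket (𝓡 (2 * n + 1)) Y Y' x)
    + Complex.I ⊗ₜ[ℝ] (VectorField.mlieBracket (𝓡 (2 * n + 1)) X Y' x
      + VectorField.mlieBracket (𝓡 (2 * n + 1)) Y X' x)

variable (n) in
/-- The differential of a complex-valued function, extended complex linearly. -/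
def complexDiff (f : M → ℂ) (x : M) : CTangent n x →ₗ[ℂ] ℂ :=
  LinearMap.liftBaseChange ℂ
    (show TangentSpace (𝓡 (2 * n + 1)) x →ₗ[ℝ] ℂ from
      (mfderiv (𝓡 (2 * n + 1)) 𝓘(ℝ, ℂ) f x).toLinearMap)

variable (n) in
/-- Smoothness of a complex-valued function on `M`. -/
def SmoothFun (f : M → ℂ) : Prop := ContMDiff (𝓡 (2 * n + 1)) 𝓘(ℝ, ℂ) ∞ f

/-! ### Real one-forms and their exterior derivatives -/

variable (n M) in
/-- Real one-forms on `M` (no regularity). -/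
abbrev OneForm : Type _ := ∀ x : M, TangentSpace (𝓡 (2 * n + 1)) x →L[ℝ] ℝ

/-- Smoothness of a one-form, as a section of the cotangent bundle. -/
def OneForm.Smooth [IsManifold (𝓡 (2 * n + 1)) ∞ M] (θ : OneForm n M) : Prop :=
  ContMDiff (𝓡 (2 * n + 1)) ((𝓡 (2 * n + 1)).prod 𝓘(ℝ, CRModel n →L[ℝ] ℝ)) ∞
    (fun x => Bundle.TotalSpace.mk' (CRModel n →L[ℝ] ℝ)
      (E := fun x : M => TangentSpace (𝓡 (2 * n + 1)) x →L[ℝ] Bundle.Trivial M ℝ x) x (θ x))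

/-- The expression of a one-form in the coordinates given by the chart at `c`. -/
def OneForm.inChart (θ : OneForm n M) (c : M) (y : CRModel n) : CRModel n →L[ℝ] ℝ :=
  (θ ((extChartAt (𝓡 (2 * n + 1)) c).symm y)).comp
    (mfderiv 𝓘(ℝ, CRModel n) (𝓡 (2 * n + 1)) (extChartAt (𝓡 (2 * n + 1)) c).symm y)

/-- The alternating bilinear form `(u, v) ↦ D u v - D v u`. -/
def skewForm {E : Type*} [NormedAddCommGroup E] [NormedSpace ℝ E] (D : E →L[ℝ] E →L[ℝ] ℝ) :
    LinearMap.BilinForm ℝ E :=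
  LinearMap.mk₂ ℝ (fun u v => D u v - D v u)
    (fun u u' v => by simp; ring) (fun c u v => by simp; ring)
    (fun u v v' => by simp; ring) (fun c u v => by simp; ring)

/-- The exterior derivative `dθ` at `x`, computed in the chart at `x`; the normalization is
`dθ(X, Y) = X θ(Y) - Y θ(X) - θ([X, Y])`. -/
def OneForm.d (θ : OneForm n M) (x : M) :
    LinearMap.BilinForm ℝ (TangentSpace (𝓡 (2 * n + 1)) x) :=
  let a : TangentSpace (𝓡 (2 * n + 1)) x →ₗ[ℝ] CRModel n :=
    (mfderiv (𝓡 (2 * n + 1)) 𝓘(ℝ, CRModel n) (extChartAt (𝓡 (2 * n + 1)) x) x).toLinearMap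
  (skewForm (fderiv ℝ (θ.inChart x) (extChartAt (𝓡 (2 * n + 1)) x x))).compl₁₂ a a

/-- `-i dθ(Z, W̄)`, with `dθ` extended complex bilinearly. -/
def OneForm.levi (θ : OneForm n M) (x : M) (Z W : CTangent n x) : ℂ :=
  -Complex.I * (LinearMap.BilinForm.baseChange ℂ (θ.d x)) Z (conjCT x W)

/-- The top-degree form `θ ∧ (dθ)^n` evaluated on `2n+1` tangent vectors; wedge products are
normalized by `(α ∧ β)(u, v) = α(u) β(v) - α(v) β(u)` for one-forms. -/
def OneForm.volForm (θ : OneForm n M) (x : M)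
    (v : Fin (2 * n + 1) → TangentSpace (𝓡 (2 * n + 1)) x) : ℝ :=
  ((2 : ℝ) ^ n)⁻¹ * ∑ σ : Equiv.Perm (Fin (2 * n + 1)),
    ((Equiv.Perm.sign σ : ℤ) : ℝ) * (θ x (v (σ 0)) *
      ∏ i : Fin n, θ.d x (v (σ ⟨2 * (i : ℕ) + 1, by omega⟩)) (v (σ ⟨2 * (i : ℕ) + 2, by omega⟩)))

/-! ### The measure `|θ ∧ (dθ)^n|` -/

/-- The measure on the domain of the chart at `c` with density `|θ ∧ (dθ)^n|` with respect to
Lebesgue measure in the coordinates, extended by zero to `M`. -/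
def OneForm.chartMeasure [MeasurableSpace M] (θ : OneForm n M) (c : M) :
    MeasureTheory.Measure M :=
  MeasureTheory.Measure.map (extChartAt (𝓡 (2 * n + 1)) c).symm
    ((MeasureTheory.volume.restrict (extChartAt (𝓡 (2 * n + 1)) c).target).withDensity
      (fun y => ENNReal.ofReal |θ.volForm ((extChartAt (𝓡 (2 * n + 1)) c).symm y)
        (fun i => mfderiv 𝓘(ℝ, CRModel n) (𝓡 (2 * n + 1)) (extChartAt (𝓡 (2 * n + 1)) c).symm y
          (EuclideanSpace.single i (1 : ℝ)))|))

variable (n M) in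
theorem exists_chartPartition [T2Space M] [SigmaCompactSpace M]
    [IsManifold (𝓡 (2 * n + 1)) ∞ M] :
    ∃ ρ : SmoothPartitionOfUnity M (𝓡 (2 * n + 1)) M,
      ρ.IsSubordinate fun c : M => (chartAt (CRModel n) c).source :=
  SmoothPartitionOfUnity.exists_isSubordinate (𝓡 (2 * n + 1)) isClosed_univ _
    (fun c => (chartAt (CRModel n) c).open_source)
    (fun x _ => Set.mem_iUnion.2 ⟨x, mem_chart_source _ x⟩)

variable (n M) in
/-- A smooth partition of unity subordinate to the domains of the charts. -/
def chartPartition [T2Space M] [SigmaCompactSpace M] [IsManifold (𝓡 (2 * n + 1)) ∞ M] :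
    SmoothPartitionOfUnity M (𝓡 (2 * n + 1)) M :=
  (exists_chartPartition n M).choose

/-- The measure on `M` defined by the volume form `θ ∧ (dθ)^n`, `M` being oriented by this form
when it vanishes nowhere. It is patched from the charts with a partition of unity (and does not
depend on the partition). -/
def OneForm.vol [T2Space M] [SigmaCompactSpace M] [IsManifold (𝓡 (2 * n + 1)) ∞ M]
    [MeasurableSpace M] (θ : OneForm n M) : MeasureTheory.Measure M :=
  MeasureTheory.Measure.sum fun c : M =>
    (θ.chartMeasure c).withDensity fun x => ENNReal.ofReal (chartPartition n M c x)

end ComplexTangent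

/-! ### CR structures and pseudohermitian structures -/

/-- A CR structure of hypersurface type on a manifold of dimension `2n+1`: a smooth complex
subbundle `T^{1,0}` of rank `n` of the complexified tangent bundle which meets its conjugate only
in zero and is closed under Lie brackets. -/
structure CRStructure (n : ℕ) (M : Type*) [TopologicalSpace M] [ChartedSpace (CRModel n) M]
    [IsManifold (𝓡 (2 * n + 1)) ∞ M] where
  /-- The bundle `T^{1,0}`. -/
  T10 : ∀ x : M, Submodule ℂ (CTangent n x)
  rank_eq : ∀ x, Module.finrank ℂ (T10 x) = n
  conj_disjoint : ∀ x, ∀ Z ∈ T10 x, conjCT x Z ∈ T10 x → Z = 0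
  /-- There are smooth local frames. -/
  smooth_frame : ∀ x₀ : M, ∃ U : Set M, IsOpen U ∧ x₀ ∈ U ∧
    ∃ X Y : Fin n → ∀ x : M, TangentSpace (𝓡 (2 * n + 1)) x,
      (∀ i, SmoothFieldOn (X i) U ∧ SmoothFieldOn (Y i) U) ∧
      ∀ x ∈ U, Submodule.span ℂ (Set.range fun i => complexField (X i) (Y i) x) = T10 x
  /-- Formal integrability. -/
  integrable : ∀ (U : Set M) (X Y X' Y' : ∀ x : M, TangentSpace (𝓡 (2 * n + 1)) x), IsOpen U →
    SmoothFieldOn X U → SmoothFieldOn Y U → SmoothFieldOn X' U → SmoothFieldOn Y' U →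
    (∀ x ∈ U, complexField X Y x ∈ T10 x) → (∀ x ∈ U, complexField X' Y' x ∈ T10 x) →
    ∀ x ∈ U, complexBracket X Y X' Y' x ∈ T10 x

/-- A strictly pseudoconvex pseudohermitian structure: a CR structure together with a nowhere
vanishing smooth real one-form `θ` which annihilates `T^{1,0}` (so that
`ker θ = Re (T^{1,0} ⊕ T^{0,1})`) and whose Levi form is positive definite. -/
structure PseudohermitianStructure (n : ℕ) (M : Type*) [TopologicalSpace M]
    [ChartedSpace (CRModel n) M] [IsManifold (𝓡 (2 * n + 1)) ∞ M] extends CRStructure n M where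
  /-- The contact form. -/
  θ : OneForm n M
  smooth_θ : θ.Smooth
  θ_ne_zero : ∀ x, θ x ≠ 0
  θ_T10 : ∀ x, ∀ Z ∈ T10 x,
    LinearMap.liftBaseChange ℂ (Complex.ofRealCLM.toLinearMap ∘ₗ (θ x).toLinearMap) Z = 0
  levi_pos : ∀ x, ∀ Z ∈ T10 x, Z ≠ 0 → 0 < (θ.levi x Z Z).re

namespace CRStructure

variable {n : ℕ} {M : Type*} [TopologicalSpace M] [ChartedSpace (CRModel n) M]
  [IsManifold (𝓡 (2 * n + 1)) ∞ M] (S : CRStructure n M)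

/-- The conjugate bundle `T^{0,1}`. -/
def T01 (x : M) : Submodule ℂ (CTangent n x) := (S.T10 x).comap (conjCT x)

/-- The conjugate of a `(1,0)`-vector, as a `(0,1)`-vector. -/
def bar {x : M} (Z : S.T10 x) : S.T01 x :=
  ⟨conjCT x Z, by simp [T01, conjCT_conjCT]⟩

/-- `∂_b f` at `x`: the restriction of `df` to `T^{1,0}`. -/
def del (f : M → ℂ) (x : M) : Module.Dual ℂ (S.T10 x) := (complexDiff n f x).domRestrict (S.T10 x)

/-- `∂̄_b f` at `x`: the restriction of `df` to `T^{0,1}`. -/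
def delbar (f : M → ℂ) (x : M) : Module.Dual ℂ (S.T01 x) :=
  (complexDiff n f x).domRestrict (S.T01 x)

/-- A basis `Z_α` of `T^{1,0}` at `x`. -/
def frame (x : M) : Module.Basis (Fin n) ℂ (S.T10 x) :=
  haveI : FiniteDimensional ℝ (TangentSpace (𝓡 (2 * n + 1)) x) :=
    inferInstanceAs (FiniteDimensional ℝ (CRModel n))
  Module.finBasisOfFinrankEq ℂ (S.T10 x) (S.rank_eq x)

end CRStructure

namespace PseudohermitianStructure

variable {n : ℕ} {M : Type*} [TopologicalSpace M] [ChartedSpace (CRModel n) M]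
  [IsManifold (𝓡 (2 * n + 1)) ∞ M] (P : PseudohermitianStructure n M)

/-- The matrix `h_{αβ̄} = -i dθ(Z_α, Z̄_β)` of the Levi form. -/
def leviMatrix (x : M) : Matrix (Fin n) (Fin n) ℂ :=
  Matrix.of fun α β => P.θ.levi x (P.frame x α) (P.frame x β)

/-- The Hermitian inner product on `(0,1)`-covectors dual to the Levi form (it does not depend on
the basis `Z_α`). -/
def inner01 {x : M} (σ τ : Module.Dual ℂ (P.T01 x)) : ℂ :=
  ∑ α, ∑ β, (P.leviMatrix x)⁻¹ α β * σ (P.bar (P.frame x α)) * conj (τ (P.bar (P.frame x β)))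

/-- The Hermitian inner product on `(1,0)`-covectors dual to the Levi form (it does not depend on
the basis `Z_α`). -/
def inner10 {x : M} (σ τ : Module.Dual ℂ (P.T10 x)) : ℂ :=
  ∑ α, ∑ β, (P.leviMatrix x)⁻¹ β α * σ (P.frame x α) * conj (τ (P.frame x β))

/-- `|σ|²` for a `(0,1)`-covector. -/
def normSq01 {x : M} (σ : Module.Dual ℂ (P.T01 x)) : ℝ := (P.inner01 σ σ).re

/-- `|σ|²` for a `(1,0)`-covector. -/
def normSq10 {x : M} (σ : Module.Dual ℂ (P.T10 x)) : ℝ := (P.inner10 σ σ).re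

variable [T2Space M] [SigmaCompactSpace M] [MeasurableSpace M]

/-- `u = ∂̄_b^* σ`, the formal adjoint with respect to the volume form `θ ∧ (dθ)^n`, for a
`(0,1)`-form `σ` on a compact `M`. -/
def IsDelbarAdjoint (σ : ∀ x, Module.Dual ℂ (P.T01 x)) (u : M → ℂ) : Prop :=
  ∀ g : M → ℂ, SmoothFun n g →
    ∫ x, u x * conj (g x) ∂P.θ.vol = ∫ x, P.inner01 (σ x) (P.delbar g x) ∂P.θ.vol

/-- `u = □_b f`, where `□_b = ∂̄_b^* ∂̄_b` is the Kohn Laplacian, for smooth functions. -/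
def IsKohnLaplacian (f u : M → ℂ) : Prop :=
  SmoothFun n f ∧ SmoothFun n u ∧ P.IsDelbarAdjoint (P.delbar f) u

/-- The eigenspace of the Kohn Laplacian for the number `lam`. -/
def eigenspace (lam : ℝ) : Set (M → ℂ) :=
  {f | P.IsKohnLaplacian f (fun x => (lam : ℂ) * f x)}

/-- The number of eigenvalues in `s`, counted with multiplicity: the dimension of the span of the
corresponding eigenfunctions. -/
def eigenvalueCount (s : Set ℝ) : Cardinal :=
  Module.rank ℂ (Submodule.span ℂ (⋃ μ ∈ s, P.eigenspace μ))

/-- `lam` is the `k`-th positive eigenvalue `λ_k` (for `k ≥ 1`) in the list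
`0 < λ_1 ≤ λ_2 ≤ ⋯` of positive eigenvalues repeated according to multiplicity. -/
def IsKthEigenvalue (k : ℕ) (lam : ℝ) : Prop :=
  0 < lam ∧ P.eigenvalueCount (Set.Ioo 0 lam) < k ∧ k ≤ P.eigenvalueCount (Set.Ioc 0 lam)

end PseudohermitianStructure

end

/-!
The weak form of `□_b ψ_j = λ ψ_j` is part of the definition of the Kohn Laplacian, and testing it
against `ψ_j h` for one well-chosen real function `h` is enough; no integration by parts is needed.

Let `r = Σ |ψ_j|²`, `σ = Σ ψ̄_j ∂̄_b ψ_j` and let `τ = Σ ψ_j ∂̄_b ψ̄_j` be the conjugate of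
`Σ ψ̄_j ∂_b ψ_j`. Then `∂̄_b r = σ + τ`, and the weak equations with test functions `ψ_j (r - 1)`
add up to
`λ ∫ (r - 1) r = ∫ (r - 1) Σ |∂̄_b ψ_j|² + Re ∫ ⟨σ, σ + τ⟩`
(`integral_weak_eigenvalue_equation`). The pointwise constraint expresses `n Σ |∂̄_b ψ_j|²` as
`(n + 1) λ r - λ`, and the identity becomes
`-λ ∫ (r - 1)² = (n / 2) (∫ |σ|² - ∫ |τ|² + ∫ |σ + τ|²)`.
The right-hand side is nonnegative by the integral hypothesis, so `r = 1` almost everywhere, hence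
everywhere (`sum_norm_sq_eq_one`).

The analytic input is that all integrands are continuous, that the measure is finite, and that it
charges nonempty open sets.
* Continuity of `⟨∂̄_b f, ∂̄_b g⟩` (`continuous_inner01_delbar`): the dual inner product does not
  depend on the basis (`inner01_eq_of_basis`), so it can be computed in smooth local frames, and
  `dθ` is smooth because its definition does not depend on the chart (`d_eq_inChart`).
* The measure (`isFiniteMeasure_vol`, `isOpenPosMeasure_vol`): the density of `θ ∧ (dθ)^n` is
  continuous and nowhere zero in each chart. It does not vanish because positivity of the Levi form
  makes `dθ` nondegenerate on `ker θ` (`exists_d_ne_zero`); in a symplectic basis of `ker θ` all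
  terms in the expansion of the top form are nonnegative (`sum_sign_mul_pos_of_symplectic`).
-/

noncomputable section

/-! ### The exterior derivative of a one-form in charts -/

section Charts

variable {n : ℕ} {M : Type*} [TopologicalSpace M] [ChartedSpace (CRModel n) M]
  [IsManifold (𝓡 (2 * n + 1)) ∞ M]

theorem isManifold_one (n : ℕ) (M : Type*) [TopologicalSpace M] [ChartedSpace (CRModel n) M]
    [IsManifold (𝓡 (2 * n + 1)) ∞ M] : IsManifold (𝓡 (2 * n + 1)) 1 M :=
  IsManifold.of_le (n := ∞) (by norm_num)

/-- Smoothness as a section of the cotangent bundle gives smoothness of the coordinate expression on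
the whole range of each chart, not only near its centre. -/
theorem OneForm.Smooth.contDiffOn_inChart {θ : OneForm n M} (h : θ.Smooth) (c : M) :
    ContDiffOn ℝ ∞ (θ.inChart c) (extChartAt (𝓡 (2 * n + 1)) c).target := by
  have := isManifold_one n M
  have h1 := ((trivializationAt (CRModel n →L[ℝ] ℝ)
    (fun x : M => TangentSpace (𝓡 (2 * n + 1)) x →L[ℝ] Bundle.Trivial M ℝ x)
      c).contMDiffOn_section_baseSet_iff (IB := 𝓡 (2 * n + 1)) (n := ∞) (s := θ)).1 h.contMDiffOn
  have h2 := h1.comp (contMDiffOn_extChartAt_symm (I := 𝓡 (2 * n + 1)) (n := ∞) c) (by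
    intro y hy
    have := (extChartAt (𝓡 (2 * n + 1)) c).map_target hy
    simpa using! this)
  rw [← contMDiffOn_iff_contDiffOn]
  refine h2.congr fun y hy => ?_
  have hs := (extChartAt (𝓡 (2 * n + 1)) c).map_target hy
  rw [extChartAt_source] at hs
  simp only [Function.comp_apply, hom_trivializationAt_apply, ContinuousLinearMap.inCoordinates]
  rw [TangentBundle.symmL_trivializationAt hs, (extChartAt (𝓡 (2 * n + 1)) c).right_inv hy]
  ext v
  simp [OneForm.inChart]

/-- The transition map from the chart at `c` to the chart at `c'`. -/
def chartTransition (c c' : M) (y : CRModel n) : CRModel n :=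
  extChartAt (𝓡 (2 * n + 1)) c' ((extChartAt (𝓡 (2 * n + 1)) c).symm y)

/-- The derivative at `x` of the chart at `c`, with the tangent space read as the model space. -/
def chartDeriv (c x : M) : CRModel n →L[ℝ] CRModel n :=
  mfderiv (𝓡 (2 * n + 1)) 𝓘(ℝ, CRModel n) (extChartAt (𝓡 (2 * n + 1)) c) x

/-- The derivative at `y` of the inverse of the chart at `c`, with the tangent space read as the
model space. -/
def chartSymmDeriv (c : M) (y : CRModel n) : CRModel n →L[ℝ] CRModel n :=
  mfderiv 𝓘(ℝ, CRModel n) (𝓡 (2 * n + 1)) (extChartAt (𝓡 (2 * n + 1)) c).symm y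

variable {c c' : M} {y : CRModel n}

theorem contDiffAt_chartTransition (hy : y ∈ (extChartAt (𝓡 (2 * n + 1)) c).target)
    (hc' : (extChartAt (𝓡 (2 * n + 1)) c).symm y ∈ (extChartAt (𝓡 (2 * n + 1)) c').source) :
    ContDiffAt ℝ ∞ (chartTransition c c' : CRModel n → CRModel n) y := by
  have := contDiffWithinAt_ext_coord_change (I := 𝓡 (2 * n + 1)) (n := ∞) c' c (y := y)
    (by rw [PartialEquiv.trans_source]; exact ⟨hy, hc'⟩)
  simpa using! this

theorem mdifferentiableAt_extChartAt_symm (hy : y ∈ (extChartAt (𝓡 (2 * n + 1)) c).target) :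
    MDifferentiableAt 𝓘(ℝ, CRModel n) (𝓡 (2 * n + 1)) (extChartAt (𝓡 (2 * n + 1)) c).symm y := by
  have := isManifold_one n M
  simpa using! mdifferentiableWithinAt_extChartAt_symm hy

theorem mdifferentiableAt_extChartAt_of_mem {x : M}
    (hx : x ∈ (extChartAt (𝓡 (2 * n + 1)) c).source) :
    MDifferentiableAt (𝓡 (2 * n + 1)) 𝓘(ℝ, CRModel n) (extChartAt (𝓡 (2 * n + 1)) c) x := by
  have := isManifold_one n M
  exact mdifferentiableAt_extChartAt (by rwa [extChartAt_source] at hx)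

theorem eventually_mem_target_and_source (hy : y ∈ (extChartAt (𝓡 (2 * n + 1)) c).target)
    (hc' : (extChartAt (𝓡 (2 * n + 1)) c).symm y ∈ (extChartAt (𝓡 (2 * n + 1)) c').source) :
    ∀ᶠ z in nhds y, z ∈ (extChartAt (𝓡 (2 * n + 1)) c).target ∧
      (extChartAt (𝓡 (2 * n + 1)) c).symm z ∈ (extChartAt (𝓡 (2 * n + 1)) c').source := by
  have h1 : ∀ᶠ z in nhds y, z ∈ (extChartAt (𝓡 (2 * n + 1)) c).target :=
    (isOpen_extChartAt_target c).mem_nhds hy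
  refine h1.and ?_
  exact (mdifferentiableAt_extChartAt_symm hy).continuousAt.eventually
    ((isOpen_extChartAt_source c').mem_nhds hc')

theorem chartDeriv_comp_chartSymmDeriv (hy : y ∈ (extChartAt (𝓡 (2 * n + 1)) c).target)
    (hc' : (extChartAt (𝓡 (2 * n + 1)) c).symm y ∈ (extChartAt (𝓡 (2 * n + 1)) c').source) :
    (chartDeriv c' ((extChartAt (𝓡 (2 * n + 1)) c).symm y)).comp (chartSymmDeriv c y)
      = fderiv ℝ (chartTransition c c' : CRModel n → CRModel n) y := by
  have h := mfderiv_comp y (mdifferentiableAt_extChartAt_of_mem hc')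
    (mdifferentiableAt_extChartAt_symm hy)
  rw [mfderiv_eq_fderiv] at h
  exact h.symm

theorem fderiv_chartTransition_comp_chartDeriv {x : M}
    (hx : x ∈ (extChartAt (𝓡 (2 * n + 1)) c).source)
    (hx' : x ∈ (extChartAt (𝓡 (2 * n + 1)) c').source) :
    (fderiv ℝ (chartTransition c c' : CRModel n → CRModel n)
      (extChartAt (𝓡 (2 * n + 1)) c x)).comp (chartDeriv c x) = chartDeriv c' x := by
  have ht := (extChartAt (𝓡 (2 * n + 1)) c).map_source hx
  have hc' : (extChartAt (𝓡 (2 * n + 1)) c).symm (extChartAt (𝓡 (2 * n + 1)) c x) ∈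
    (extChartAt (𝓡 (2 * n + 1)) c').source := by rwa [(extChartAt _ c).left_inv hx]
  have h := mfderiv_comp (I := 𝓡 (2 * n + 1)) (I' := 𝓘(ℝ, CRModel n)) (I'' := 𝓘(ℝ, CRModel n)) x
    ((contDiffAt_chartTransition ht hc').differentiableAt (by simp)).mdifferentiableAt
    (mdifferentiableAt_extChartAt_of_mem hx)
  rw [mfderiv_eq_fderiv] at h
  refine h.symm.trans (Filter.EventuallyEq.mfderiv_eq ?_)
  filter_upwards [(isOpen_extChartAt_source (I := 𝓡 (2 * n + 1)) c).mem_nhds hx] with z hz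
  simp only [Function.comp_apply, chartTransition]
  rw [(extChartAt (𝓡 (2 * n + 1)) c).left_inv hz]

theorem chartSymmDeriv_comp_fderiv_chartTransition
    (hy : y ∈ (extChartAt (𝓡 (2 * n + 1)) c).target)
    (hc' : (extChartAt (𝓡 (2 * n + 1)) c).symm y ∈ (extChartAt (𝓡 (2 * n + 1)) c').source) :
    (chartSymmDeriv c' (chartTransition c c' y)).comp
      (fderiv ℝ (chartTransition c c' : CRModel n → CRModel n) y) = chartSymmDeriv c y := by
  have ht : chartTransition c c' y ∈ (extChartAt (𝓡 (2 * n + 1)) c').target :=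
    (extChartAt (𝓡 (2 * n + 1)) c').map_source hc'
  have h := mfderiv_comp (I := 𝓘(ℝ, CRModel n)) (I' := 𝓘(ℝ, CRModel n)) y
    (mdifferentiableAt_extChartAt_symm ht)
    ((contDiffAt_chartTransition hy hc').differentiableAt (by simp)).mdifferentiableAt
  rw [mfderiv_eq_fderiv] at h
  refine h.symm.trans (Filter.EventuallyEq.mfderiv_eq ?_)
  filter_upwards [eventually_mem_target_and_source hy hc'] with z hz
  exact (extChartAt (𝓡 (2 * n + 1)) c').left_inv hz.2

/-- In two charts, the expressions of a one-form are related by pull-back under the transition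
map. -/
theorem OneForm.inChart_eq_pullback (θ : OneForm n M)
    (hy : y ∈ (extChartAt (𝓡 (2 * n + 1)) c).target)
    (hc' : (extChartAt (𝓡 (2 * n + 1)) c).symm y ∈ (extChartAt (𝓡 (2 * n + 1)) c').source) :
    θ.inChart c y = (θ.inChart c' (chartTransition c c' y)).comp
      (fderiv ℝ (chartTransition c c' : CRModel n → CRModel n) y) := by
  have h1 : (extChartAt (𝓡 (2 * n + 1)) c').symm (chartTransition c c' y)
      = (extChartAt (𝓡 (2 * n + 1)) c).symm y := (extChartAt (𝓡 (2 * n + 1)) c').left_inv hc'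
  have h2 (c : M) (y : CRModel n) : θ.inChart c y =
    ContinuousLinearMap.comp (show CRModel n →L[ℝ] ℝ from
      θ ((extChartAt (𝓡 (2 * n + 1)) c).symm y)) (chartSymmDeriv c y) := rfl
  rw [h2, h2, h1, ← chartSymmDeriv_comp_fderiv_chartTransition hy hc']
  rfl

/-- Exterior differentiation of one-forms on a vector space commutes with pull-back: the term with
the second derivative of the map is symmetric and drops out. -/
theorem skewForm_fderiv_pullback {E : Type*} [NormedAddCommGroup E] [NormedSpace ℝ E]
    {α : E → E →L[ℝ] ℝ} {κ : E → E} {y : E} (hα : DifferentiableAt ℝ α (κ y))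
    (hκ : ContDiffAt ℝ ∞ κ y) (u v : E) :
    skewForm (fderiv ℝ (fun z => (α (κ z)).comp (fderiv ℝ κ z)) y) u v =
      skewForm (fderiv ℝ α (κ y)) (fderiv ℝ κ y u) (fderiv ℝ κ y v) := by
  have h1 : DifferentiableAt ℝ κ y := hκ.differentiableAt (by simp)
  have h2 : DifferentiableAt ℝ (fderiv ℝ κ) y :=
    (hκ.fderiv_right (m := 1) (by norm_cast)).differentiableAt (by simp)
  have h3 : HasFDerivAt (fun z => α (κ z)) ((fderiv ℝ α (κ y)).comp (fderiv ℝ κ y)) y :=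
    hα.hasFDerivAt.comp y h1.hasFDerivAt
  have hsymm : IsSymmSndFDerivAt ℝ κ y := hκ.isSymmSndFDerivAt (by simp; norm_cast)
  rw [(h3.clm_comp h2.hasFDerivAt).fderiv]
  simp [skewForm, hsymm.eq u v]

/-- The exterior derivative, defined with the chart at `x`, can be computed at `x` in every chart
whose domain contains `x`. -/
theorem OneForm.Smooth.d_eq_inChart {θ : OneForm n M} (h : θ.Smooth) {c x : M}
    (hx : x ∈ (extChartAt (𝓡 (2 * n + 1)) c).source) (u v : TangentSpace (𝓡 (2 * n + 1)) x) :
    θ.d x u v = skewForm (fderiv ℝ (θ.inChart c) (extChartAt (𝓡 (2 * n + 1)) c x))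
      (chartDeriv c x u) (chartDeriv c x v) := by
  have hy : extChartAt (𝓡 (2 * n + 1)) x x ∈ (extChartAt (𝓡 (2 * n + 1)) x).target :=
    mem_extChartAt_target x
  have hxx : (extChartAt (𝓡 (2 * n + 1)) x).symm (extChartAt (𝓡 (2 * n + 1)) x x) = x :=
    extChartAt_to_inv x
  have hc' : (extChartAt (𝓡 (2 * n + 1)) x).symm (extChartAt (𝓡 (2 * n + 1)) x x) ∈
    (extChartAt (𝓡 (2 * n + 1)) c).source := by rwa [hxx]
  have hκ : chartTransition x c (extChartAt (𝓡 (2 * n + 1)) x x) =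
      extChartAt (𝓡 (2 * n + 1)) c x := by rw [chartTransition, hxx]
  have hev : θ.inChart x =ᶠ[nhds (extChartAt (𝓡 (2 * n + 1)) x x)] fun z =>
      (θ.inChart c (chartTransition x c z)).comp
      (fderiv ℝ (chartTransition x c : CRModel n → CRModel n) z) := by
    filter_upwards [eventually_mem_target_and_source hy hc'] with z hz
    exact θ.inChart_eq_pullback hz.1 hz.2
  have hdiff : DifferentiableAt ℝ (θ.inChart c)
      (chartTransition x c (extChartAt (𝓡 (2 * n + 1)) x x)) := by
    rw [hκ]
    have ht := (extChartAt (𝓡 (2 * n + 1)) c).map_source hx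
    exact ((h.contDiffOn_inChart c).contDiffAt
      ((isOpen_extChartAt_target c).mem_nhds ht)).differentiableAt (by simp)
  have h1 : θ.d x u v = skewForm (fderiv ℝ (θ.inChart x) (extChartAt (𝓡 (2 * n + 1)) x x))
      (chartDeriv x x u) (chartDeriv x x v) := rfl
  rw [h1, hev.fderiv_eq, skewForm_fderiv_pullback hdiff (contDiffAt_chartTransition hy hc'), hκ,
    ← fderiv_chartTransition_comp_chartDeriv (mem_extChartAt_source x) hx]
  rfl

end Charts

/-! ### Nondegenerate alternating forms and the top form `θ ∧ (dθ)^n` -/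

section Symplectic

/-- A nondegenerate alternating form on a real vector space of dimension `2n` has a symplectic
basis. -/
theorem exists_symplectic_frame (n : ℕ) {V : Type*} [AddCommGroup V] [Module ℝ V]
    [FiniteDimensional ℝ V] (B : LinearMap.BilinForm ℝ V) (hB : ∀ u v, B u v = -B v u)
    (hnd : ∀ u, u ≠ 0 → ∃ v, B u v ≠ 0) (hdim : Module.finrank ℝ V = 2 * n) :
    ∃ e f : Fin n → V, (∀ i j, B (e i) (e j) = 0) ∧ (∀ i j, B (f i) (f j) = 0) ∧
      ∀ i j, B (e i) (f j) = if i = j then 1 else 0 := by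
  induction n generalizing V with
  | zero => exact ⟨Fin.elim0, Fin.elim0, fun i => i.elim0, fun i => i.elim0, fun i => i.elim0⟩
  | succ n ih =>
    have hself (u : V) : B u u = 0 := by linarith [hB u u]
    have : Nontrivial V := Module.nontrivial_of_finrank_pos (R := ℝ) (by omega)
    obtain ⟨e, he⟩ := exists_ne (0 : V)
    obtain ⟨f', hf'⟩ := hnd e he
    obtain ⟨f, hf⟩ : ∃ f, B e f = 1 := ⟨(B e f')⁻¹ • f', by simp [hf']⟩
    have hfe : B f e = -1 := by rw [hB, hf]
    -- The symplectic complement of the plane spanned by `e` and `f`.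
    let L : V →ₗ[ℝ] ℝ × ℝ := (B e).prod (B f)
    have hL : L.range = ⊤ := by
      rw [LinearMap.range_eq_top]
      intro p
      exact ⟨p.1 • f - p.2 • e, by ext <;> simp [L, hf, hfe, hself]⟩
    have hmem (w : V) : w ∈ L.ker ↔ B e w = 0 ∧ B f w = 0 := by
      simp [L]
    obtain ⟨e', f', h1, h2, h3⟩ := ih (V := L.ker) (B.domRestrict₁₂ L.ker L.ker)
      (fun u v => hB u v)
      (fun u hu => by
        obtain ⟨w, hw⟩ := hnd (u : V) (by simpa using hu)
        obtain ⟨hu1, hu2⟩ := (hmem u).1 u.2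
        -- The projection of `w` along the plane; it pairs with `u` in the same way as `w`.
        refine ⟨⟨w - B e w • f + B f w • e, ?_⟩, ?_⟩
        · rw [hmem]; simp [hf, hfe, hself]
        · rw [hB] at hu1 hu2
          simp only [neg_eq_zero] at hu1 hu2
          change B (u : V) (w - B e w • f + B f w • e) ≠ 0
          simpa [hu1, hu2] using hw)
      (by
        have := L.finrank_range_add_finrank_ker
        rw [hL, finrank_top] at this
        simp at this
        omega)
    refine ⟨Fin.cons e fun i => (e' i : V), Fin.cons f fun i => (f' i : V), ?_, ?_, ?_⟩
    · intro i j
      refine Fin.cases (Fin.cases ?_ (fun j => ?_) j) (fun i => Fin.cases ?_ (fun j => ?_) j) i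
      · simp [hself]
      · simpa using ((hmem _).1 (e' j).2).1
      · rw [hB]; simpa using ((hmem _).1 (e' i).2).1
      · exact h1 i j
    · intro i j
      refine Fin.cases (Fin.cases ?_ (fun j => ?_) j) (fun i => Fin.cases ?_ (fun j => ?_) j) i
      · simp [hself]
      · simpa using ((hmem _).1 (f' j).2).2
      · rw [hB]; simpa using ((hmem _).1 (f' i).2).2
      · exact h2 i j
    · intro i j
      refine Fin.cases (Fin.cases ?_ (fun j => ?_) j) (fun i => Fin.cases ?_ (fun j => ?_) j) i
      · simp [hf]
      · simpa [(Fin.succ_ne_zero j).symm] using ((hmem _).1 (f' j).2).1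
      · rw [hB]; simpa [Fin.succ_ne_zero i] using ((hmem _).1 (e' i).2).2
      · simpa using! h3 i j

/-- The value of the standard symplectic form on the basis vectors with indices `p` and `q`; the
index `(i, false)` stands for `e i` and `(i, true)` for `f i`. -/
def symplecticEntry {n : ℕ} (p q : Fin n × Bool) : ℝ :=
  if p.1 = q.1 then (if p.2 = q.2 then 0 else if p.2 then -1 else 1) else 0

/-- A permutation which contributes to the Pfaffian of the standard symplectic form permutes the
planes and flips some of them; each flip contributes the same sign to both factors. -/
theorem sign_mul_prod_symplecticEntry_nonneg {n : ℕ} (τ : Equiv.Perm (Fin n × Bool)) :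
    0 ≤ ((Equiv.Perm.sign τ : ℤ) : ℝ) *
      ∏ i, symplecticEntry (τ (i, false)) (τ (i, true)) := by
  by_cases h0 : ∏ i, symplecticEntry (τ (i, false)) (τ (i, true)) = 0
  · rw [h0, mul_zero]
  have h1 (i) : (τ (i, false)).1 = (τ (i, true)).1 ∧ (τ (i, false)).2 ≠ (τ (i, true)).2 := by
    have := Finset.prod_ne_zero_iff.1 h0 i (Finset.mem_univ i)
    rw [symplecticEntry] at this
    split_ifs at this <;> simp_all
  have hinj : Function.Injective fun i => (τ (i, false)).1 := by
    intro i j hij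
    by_contra hne
    have hcases : τ (j, false) = τ (i, false) ∨ τ (j, false) = τ (i, true) := by
      have hb : ∀ a b c : Bool, b ≠ c → a = b ∨ a = c := by decide
      exact (hb (τ (j, false)).2 _ _ (h1 i).2).imp (fun h => Prod.ext hij.symm h)
        fun h => Prod.ext (hij.symm.trans (h1 i).1) h
    rcases hcases with h | h
    · exact hne (congrArg Prod.fst (τ.injective h)).symm
    · exact Bool.false_ne_true (congrArg Prod.snd (τ.injective h))
  -- `τ` first flips the planes selected by `s` and then permutes the planes by `κ`.
  let κ : Equiv.Perm (Fin n) := Equiv.ofBijective _ (Finite.injective_iff_bijective.1 hinj)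
  let s : Fin n → Equiv.Perm Bool := fun i => if (τ (i, false)).2 then Equiv.swap false true else 1
  have hτ : τ = Equiv.prodCongrLeft (fun _ : Bool => κ) * Equiv.prodCongrRight s := by
    ext1 ⟨i, b⟩
    have := h1 i
    refine Prod.ext ?_ ?_
    · rcases b with _ | _ <;> simp [κ, this.1]
    · simp only [Equiv.Perm.coe_mul, Function.comp_apply, Equiv.prodCongrRight_apply,
        Equiv.prodCongrLeft_apply, s]
      rcases hc : (τ (i, false)).2 with _ | _ <;>
        rcases hd : (τ (i, true)).2 with _ | _ <;> rcases b with _ | _ <;> simp_all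
  have hsign : ((Equiv.Perm.sign τ : ℤ) : ℝ) = ∏ i, ((Equiv.Perm.sign (s i) : ℤ) : ℝ) := by
    rw [hτ, map_mul, Equiv.Perm.sign_prodCongrLeft, Equiv.Perm.sign_prodCongrRight]
    simp
  rw [hsign, ← Finset.prod_mul_distrib]
  refine Finset.prod_nonneg fun i _ => ?_
  have := h1 i
  simp only [symplecticEntry, this.1, this.2, if_true, if_false, s]
  split_ifs <;> simp

/-- The positions `none`, `(i, false)`, `(i, true)` correspond to `0`, `2i+1`, `2i+2`. -/
def oddIndexEquiv (n : ℕ) : Option (Fin n × Bool) ≃ Fin (2 * n + 1) where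
  toFun
    | none => 0
    | some (i, false) => ⟨2 * (i : ℕ) + 1, by omega⟩
    | some (i, true) => ⟨2 * (i : ℕ) + 2, by omega⟩
  invFun k := if h : (k : ℕ) = 0 then none
    else some (⟨((k : ℕ) - 1) / 2, by omega⟩, decide ((k : ℕ) % 2 = 0))
  left_inv
    | none => by simp
    | some (i, false) => by
      simp only [Nat.add_eq_zero_iff, one_ne_zero, and_false, dite_false, Option.some.injEq,
        Prod.mk.injEq, Fin.ext_iff, decide_eq_false_iff_not]
      omega
    | some (i, true) => by
      simp only [Nat.add_eq_zero_iff, OfNat.ofNat_ne_zero, and_false, dite_false,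
        Option.some.injEq, Prod.mk.injEq, Fin.ext_iff, decide_eq_true_eq]
      omega
  right_inv k := by
    by_cases h : (k : ℕ) = 0
    · simp only [h, dite_true]; exact (Fin.ext h).symm
    · simp only [h, dite_false]
      rcases Nat.mod_two_eq_zero_or_one k with h2 | h2
      · simp only [h2, decide_true]; ext; simp; omega
      · simp only [h2, one_ne_zero, decide_false]; ext; simp; omega

variable {n : ℕ} {V : Type*} [AddCommGroup V] [Module ℝ V]

/-- On a symplectic basis of `ker α`, completed by a vector on which `α` is one, the form
`α ∧ B^n` is positive: all terms of its expansion are nonnegative. -/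
theorem sum_sign_mul_pos_of_symplectic (α : V →ₗ[ℝ] ℝ) (B : LinearMap.BilinForm ℝ V)
    (hB : ∀ u v, B u v = -B v u) (T : V) (hT : α T = 1) (e f : Fin n → V)
    (he : ∀ i, α (e i) = 0) (hf : ∀ i, α (f i) = 0)
    (hee : ∀ i j, B (e i) (e j) = 0) (hff : ∀ i j, B (f i) (f j) = 0)
    (hef : ∀ i j, B (e i) (f j) = if i = j then 1 else 0) :
    ∃ w : Fin (2 * n + 1) → V, 0 < ∑ σ : Equiv.Perm (Fin (2 * n + 1)),
      ((Equiv.Perm.sign σ : ℤ) : ℝ) * (α (w (σ 0)) *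
      ∏ i : Fin n, B (w (σ ⟨2 * (i : ℕ) + 1, by omega⟩)) (w (σ ⟨2 * (i : ℕ) + 2, by omega⟩))) := by
  let w' : Option (Fin n × Bool) → V := fun p => p.elim T fun q => if q.2 then f q.1 else e q.1
  have hw (p q : Fin n × Bool) : B (w' (some p)) (w' (some q)) = symplecticEntry p q := by
    obtain ⟨i, b⟩ := p
    obtain ⟨j, c⟩ := q
    rcases b with _ | _ <;> rcases c with _ | _
    · simp [w', symplecticEntry, hee]
    · simp [w', symplecticEntry, hef]
    · have := hB (f i) (e j)
      simp only [hef, eq_comm (a := j)] at this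
      simp [w', symplecticEntry, this, apply_ite]
    · simp [w', symplecticEntry, hff]
  have hα (p : Fin n × Bool) : α (w' (some p)) = 0 := by
    obtain ⟨i, b⟩ := p
    rcases b with _ | _ <;> simp [w', he, hf]
  let ε := oddIndexEquiv n
  refine ⟨w' ∘ ε.symm, ?_⟩
  have hε0 : (0 : Fin (2 * n + 1)) = ε none := rfl
  have hε1 (i : Fin n) : (⟨2 * (i : ℕ) + 1, by omega⟩ : Fin (2 * n + 1)) = ε (some (i, false)) :=
    rfl
  have hε2 (i : Fin n) : (⟨2 * (i : ℕ) + 2, by omega⟩ : Fin (2 * n + 1)) = ε (some (i, true)) :=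
    rfl
  simp only [hε0, hε1, hε2]
  rw [← Equiv.sum_comp ε.permCongr]
  simp only [Equiv.Perm.sign_permCongr, Equiv.permCongr_apply, Function.comp_apply,
    Equiv.symm_apply_apply]
  refine Finset.sum_pos' (fun σ _ => ?_) ⟨1, Finset.mem_univ _, ?_⟩
  -- A term vanishes unless `σ` fixes the index of `T`.
  · rcases hσ : σ none with _ | p
    · have hσ' : σ = Equiv.optionCongr (Equiv.removeNone σ) := by
        rw [map_equiv_removeNone, hσ, Equiv.swap_self]
        rfl
      rw [hσ', Equiv.optionCongr_sign]
      simp only [Equiv.optionCongr_apply, Option.map_some, hw]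
      have := sign_mul_prod_symplecticEntry_nonneg (Equiv.removeNone σ)
      simpa [w', hT] using this
    · simp [hα]
  · simp only [Equiv.Perm.one_apply, hw, Equiv.Perm.sign_one]
    simp [symplecticEntry, w', hT]

/-- The multilinear map `v ↦ α (v 0) * ∏ B (v (2i+1)) (v (2i+2))`, whose alternatization is
`α ∧ B^n` up to normalization. -/
def tensorTop (n : ℕ) (α : V →ₗ[ℝ] ℝ) (B : LinearMap.BilinForm ℝ V) :
    MultilinearMap ℝ (fun _ : Fin (2 * n + 1) => V) ℝ :=
  -- As a function of a single argument, the product is linear.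
  have key (v : Fin (2 * n + 1) → V) (j : Fin (2 * n + 1)) : ∃ L : V →ₗ[ℝ] ℝ, ∀ x,
      α (Function.update v j x 0) * ∏ i : Fin n,
        B (Function.update v j x ⟨2 * (i : ℕ) + 1, by omega⟩)
          (Function.update v j x ⟨2 * (i : ℕ) + 2, by omega⟩) = L x := by
    by_cases hj : j = 0
    · refine ⟨(∏ i : Fin n, B (v ⟨2 * (i : ℕ) + 1, by omega⟩)
          (v ⟨2 * (i : ℕ) + 2, by omega⟩)) • α, fun x => ?_⟩
      subst hj
      simp [Fin.ext_iff, mul_comm]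
    · have hj' : (j : ℕ) ≠ 0 := fun h => hj (Fin.ext h)
      let i₀ : Fin n := ⟨((j : ℕ) - 1) / 2, by omega⟩
      let c : ℝ := α (v 0) * ∏ i ∈ Finset.univ.erase i₀, B (v ⟨2 * (i : ℕ) + 1, by omega⟩)
          (v ⟨2 * (i : ℕ) + 2, by omega⟩)
      have hc (x : V) : ∏ i ∈ Finset.univ.erase i₀,
          B (Function.update v j x ⟨2 * (i : ℕ) + 1, by omega⟩)
          (Function.update v j x ⟨2 * (i : ℕ) + 2, by omega⟩) = ∏ i ∈ Finset.univ.erase i₀,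
          B (v ⟨2 * (i : ℕ) + 1, by omega⟩) (v ⟨2 * (i : ℕ) + 2, by omega⟩) := by
        refine Finset.prod_congr rfl fun i hi => ?_
        have hi' : (i : ℕ) ≠ ((j : ℕ) - 1) / 2 := fun h =>
          (Finset.mem_erase.1 hi).1 (Fin.ext h)
        rw [Function.update_of_ne, Function.update_of_ne] <;>
          · rw [Ne, Fin.ext_iff]; simp only; omega
      have h0 (x : V) : Function.update v j x 0 = v 0 := Function.update_of_ne (Ne.symm hj) _ _
      rcases Nat.mod_two_eq_zero_or_one j with h2 | h2
      · have hj2 : (⟨2 * (i₀ : ℕ) + 2, by omega⟩ : Fin (2 * n + 1)) = j := by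
          ext; simp only [i₀]; omega
        have hj1 : (⟨2 * (i₀ : ℕ) + 1, by omega⟩ : Fin (2 * n + 1)) ≠ j := by
          rw [Ne, Fin.ext_iff]; simp only [i₀]; omega
        refine ⟨c • B (v ⟨2 * (i₀ : ℕ) + 1, by omega⟩), fun x => ?_⟩
        rw [← Finset.mul_prod_erase Finset.univ _ (Finset.mem_univ i₀), hc, h0, hj2,
          Function.update_self, Function.update_of_ne hj1]
        simp only [LinearMap.smul_apply, smul_eq_mul, c]
        ring
      · have hj2 : (⟨2 * (i₀ : ℕ) + 2, by omega⟩ : Fin (2 * n + 1)) ≠ j := by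
          rw [Ne, Fin.ext_iff]; simp only [i₀]; omega
        have hj1 : (⟨2 * (i₀ : ℕ) + 1, by omega⟩ : Fin (2 * n + 1)) = j := by
          ext; simp only [i₀]; omega
        refine ⟨c • LinearMap.flip B (v ⟨2 * (i₀ : ℕ) + 2, by omega⟩), fun x => ?_⟩
        rw [← Finset.mul_prod_erase Finset.univ _ (Finset.mem_univ i₀), hc, h0, hj1,
          Function.update_self, Function.update_of_ne hj2]
        rw [LinearMap.smul_apply, LinearMap.flip_apply, smul_eq_mul]
        simp only [c]
        ring
  { toFun v := α (v 0) * ∏ i : Fin n,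
      B (v ⟨2 * (i : ℕ) + 1, by omega⟩) (v ⟨2 * (i : ℕ) + 2, by omega⟩)
    map_update_add' := by
      intro hdec v j x y
      rw [Subsingleton.elim hdec (instDecidableEqFin _)]
      obtain ⟨L, hL⟩ := key v j
      rw [hL, hL, hL, map_add]
    map_update_smul' := by
      intro hdec v j c x
      rw [Subsingleton.elim hdec (instDecidableEqFin _)]
      obtain ⟨L, hL⟩ := key v j
      rw [hL, hL, map_smul] }

/-- If `B` is an alternating form which is nondegenerate on the hyperplane `ker α`, then
`α ∧ B^n` does not vanish on a basis. -/
theorem sum_sign_mul_ne_zero_of_basis [FiniteDimensional ℝ V] (α : V →ₗ[ℝ] ℝ) (hα : α ≠ 0)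
    (B : LinearMap.BilinForm ℝ V) (hB : ∀ u v, B u v = -B v u)
    (hnd : ∀ u, α u = 0 → u ≠ 0 → ∃ v, α v = 0 ∧ B u v ≠ 0)
    (b : Module.Basis (Fin (2 * n + 1)) ℝ V) :
    ∑ σ : Equiv.Perm (Fin (2 * n + 1)), ((Equiv.Perm.sign σ : ℤ) : ℝ) * (α (b (σ 0)) *
      ∏ i : Fin n, B (b (σ ⟨2 * (i : ℕ) + 1, by omega⟩)) (b (σ ⟨2 * (i : ℕ) + 2, by omega⟩)))
      ≠ 0 := by
  have hval (v : Fin (2 * n + 1) → V) :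
      MultilinearMap.alternatization (tensorTop n α B) v =
      ∑ σ : Equiv.Perm (Fin (2 * n + 1)), ((Equiv.Perm.sign σ : ℤ) : ℝ) * (α (v (σ 0)) *
      ∏ i : Fin n, B (v (σ ⟨2 * (i : ℕ) + 1, by omega⟩))
        (v (σ ⟨2 * (i : ℕ) + 2, by omega⟩))) := by
    rw [MultilinearMap.alternatization_apply]
    refine Finset.sum_congr rfl fun σ _ => ?_
    rw [Units.smul_def, zsmul_eq_mul]
    rfl
  have hsurj : Function.Surjective α := LinearMap.surjective hα
  obtain ⟨T, hT⟩ := hsurj 1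
  have hdim : Module.finrank ℝ α.ker = 2 * n := by
    have h1 := α.finrank_range_add_finrank_ker
    rw [LinearMap.range_eq_top.2 hsurj, finrank_top, Module.finrank_self,
      Module.finrank_eq_card_basis b, Fintype.card_fin] at h1
    omega
  obtain ⟨e, f, h1, h2, h3⟩ := exists_symplectic_frame n (B.domRestrict₁₂ α.ker α.ker)
    (fun u v => hB u v)
    (fun u hu => by
      obtain ⟨v, hv, hv'⟩ := hnd u u.2 (by simpa using hu)
      exact ⟨⟨v, hv⟩, hv'⟩) hdim
  obtain ⟨w, hw⟩ := sum_sign_mul_pos_of_symplectic α B hB T hT (fun i => (e i : V))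
    (fun i => (f i : V)) (fun i => (e i).2) (fun i => (f i).2) h1 h2 h3
  rw [← hval] at hw ⊢
  intro hzero
  have : MultilinearMap.alternatization (tensorTop n α B) = 0 :=
    (AlternatingMap.map_basis_eq_zero_iff b _).1 hzero
  rw [this] at hw
  simp at hw

end Symplectic

/-! ### Complex tangent vectors and the Levi form -/

section LeviForm

variable {n : ℕ} {M : Type*} [TopologicalSpace M] [ChartedSpace (CRModel n) M]

theorem finiteDimensional_tangentSpace (x : M) :
    FiniteDimensional ℝ (TangentSpace (𝓡 (2 * n + 1)) x) :=
  inferInstanceAs (FiniteDimensional ℝ (CRModel n))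

theorem exists_eq_re_add_im {x : M} (Z : CTangent n x) :
    ∃ X Y : TangentSpace (𝓡 (2 * n + 1)) x, Z = (1 : ℂ) ⊗ₜ[ℝ] X + Complex.I ⊗ₜ[ℝ] Y := by
  induction Z using TensorProduct.induction_on with
  | zero => exact ⟨0, 0, by simp⟩
  | tmul a v =>
    refine ⟨a.re • v, a.im • v, ?_⟩
    rw [TensorProduct.tmul_smul, TensorProduct.tmul_smul, TensorProduct.smul_tmul',
      TensorProduct.smul_tmul', ← TensorProduct.add_tmul]
    congr 1
    apply Complex.ext <;> simp
  | add a b ha hb =>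
    obtain ⟨X, Y, rfl⟩ := ha
    obtain ⟨X', Y', rfl⟩ := hb
    refine ⟨X + X', Y + Y', ?_⟩
    rw [TensorProduct.tmul_add, TensorProduct.tmul_add]
    abel

theorem conjCT_re_add_im {x : M} (X Y : TangentSpace (𝓡 (2 * n + 1)) x) :
    conjCT x ((1 : ℂ) ⊗ₜ[ℝ] X + Complex.I ⊗ₜ[ℝ] Y) =
      (1 : ℂ) ⊗ₜ[ℝ] X - Complex.I ⊗ₜ[ℝ] Y := by
  rw [map_add]
  simp [conjCT, TensorProduct.neg_tmul, sub_eq_add_neg]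

/-- The real part of a complex tangent vector. -/
def reCT (x : M) : CTangent n x →ₗ[ℝ] TangentSpace (𝓡 (2 * n + 1)) x :=
  (TensorProduct.lid ℝ _).toLinearMap ∘ₗ
    LinearMap.rTensor (TangentSpace (𝓡 (2 * n + 1)) x) Complex.reLm

theorem reCT_re_add_im {x : M} (X Y : TangentSpace (𝓡 (2 * n + 1)) x) :
    reCT x ((1 : ℂ) ⊗ₜ[ℝ] X + Complex.I ⊗ₜ[ℝ] Y) = X := by
  rw [map_add]
  simp [reCT]

namespace OneForm

variable (θ : OneForm n M)

theorem d_swap (x : M) (u v : TangentSpace (𝓡 (2 * n + 1)) x) : θ.d x u v = -θ.d x v u := by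
  have key (D : CRModel n →L[ℝ] CRModel n →L[ℝ] ℝ) (a b : CRModel n) :
      skewForm D a b = -skewForm D b a := by simp [skewForm]
  exact key _ _ _

theorem levi_re_add_im {x : M} (X Y X' Y' : TangentSpace (𝓡 (2 * n + 1)) x) :
    θ.levi x ((1 : ℂ) ⊗ₜ[ℝ] X + Complex.I ⊗ₜ[ℝ] Y) ((1 : ℂ) ⊗ₜ[ℝ] X' + Complex.I ⊗ₜ[ℝ] Y') =
      ((θ.d x Y X' - θ.d x X Y' : ℝ) : ℂ) - ((θ.d x X X' + θ.d x Y Y' : ℝ) : ℂ) * Complex.I := by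
  rw [levi, conjCT_re_add_im]
  simp only [map_add, map_sub, LinearMap.add_apply, LinearMap.BilinForm.baseChange_tmul]
  apply Complex.ext <;> simp

theorem levi_self {x : M} (X Y : TangentSpace (𝓡 (2 * n + 1)) x) :
    θ.levi x ((1 : ℂ) ⊗ₜ[ℝ] X + Complex.I ⊗ₜ[ℝ] Y) ((1 : ℂ) ⊗ₜ[ℝ] X + Complex.I ⊗ₜ[ℝ] Y) =
      ((-2 * θ.d x X Y : ℝ) : ℂ) := by
  have h1 := θ.d_swap x X X
  have h2 := θ.d_swap x Y Y
  have h3 : θ.d x X X = 0 := by linarith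
  have h4 : θ.d x Y Y = 0 := by linarith
  rw [levi_re_add_im, θ.d_swap x Y X, h3, h4]
  push_cast
  ring

theorem conj_levi {x : M} (Z W : CTangent n x) : conj (θ.levi x Z W) = θ.levi x W Z := by
  obtain ⟨X, Y, rfl⟩ := exists_eq_re_add_im Z
  obtain ⟨X', Y', rfl⟩ := exists_eq_re_add_im W
  rw [levi_re_add_im, levi_re_add_im, θ.d_swap x Y', θ.d_swap x X' Y, θ.d_swap x X' X,
    θ.d_swap x Y' Y]
  apply Complex.ext <;> simp
  all_goals ring

theorem levi_add_left {x : M} (Z Z' W : CTangent n x) :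
    θ.levi x (Z + Z') W = θ.levi x Z W + θ.levi x Z' W := by
  simp [levi, mul_add]

theorem levi_smul_left {x : M} (c : ℂ) (Z W : CTangent n x) :
    θ.levi x (c • Z) W = c * θ.levi x Z W := by
  simp [levi]; ring

theorem levi_sum_left {x : M} {ι : Type*} (s : Finset ι) (c : ι → ℂ) (Z : ι → CTangent n x)
    (W : CTangent n x) :
    θ.levi x (∑ i ∈ s, c i • Z i) W = ∑ i ∈ s, c i * θ.levi x (Z i) W := by
  classical
  induction s using Finset.induction_on with
  | empty => simp [levi]
  | insert a s ha ih =>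
    rw [Finset.sum_insert ha, Finset.sum_insert ha, levi_add_left, levi_smul_left, ih]

theorem levi_sum_right {x : M} {ι : Type*} (s : Finset ι) (c : ι → ℂ) (Z : ι → CTangent n x)
    (W : CTangent n x) :
    θ.levi x W (∑ i ∈ s, c i • Z i) = ∑ i ∈ s, conj (c i) * θ.levi x W (Z i) := by
  rw [← conj_levi, levi_sum_left, map_sum]
  exact Finset.sum_congr rfl fun i _ => by rw [map_mul, conj_levi]

end OneForm

end LeviForm

namespace PseudohermitianStructure

open Matrix
open scoped ComplexOrder

variable {n : ℕ} {M : Type*} [TopologicalSpace M] [ChartedSpace (CRModel n) M]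
  [IsManifold (𝓡 (2 * n + 1)) ∞ M] (P : PseudohermitianStructure n M) {x : M}

/-- The Levi form is nondegenerate on the contact hyperplane: the real part of
`Z = X + iY` in `T^{1,0}` pairs nontrivially with the imaginary part, and every vector of the
hyperplane is such a real part, by a count of dimensions. -/
theorem exists_d_ne_zero (u : TangentSpace (𝓡 (2 * n + 1)) x) (hu : P.θ x u = 0) (hu0 : u ≠ 0) :
    ∃ v, P.θ x v = 0 ∧ P.θ.d x u v ≠ 0 := by
  have := finiteDimensional_tangentSpace (n := n) x
  let R : (P.T10 x).restrictScalars ℝ →ₗ[ℝ] TangentSpace (𝓡 (2 * n + 1)) x :=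
    (reCT x).domRestrict _
  have hθ (X Y : TangentSpace (𝓡 (2 * n + 1)) x)
      (h : (1 : ℂ) ⊗ₜ[ℝ] X + Complex.I ⊗ₜ[ℝ] Y ∈ P.T10 x) : P.θ x X = 0 ∧ P.θ x Y = 0 := by
    have := P.θ_T10 x _ h
    rw [map_add, LinearMap.liftBaseChange_tmul, LinearMap.liftBaseChange_tmul] at this
    have h1 := congrArg Complex.re this
    have h2 := congrArg Complex.im this
    simpa using And.intro h1 h2
  -- If `Z = iY` then `Z` and its conjugate `-Z` both lie in `T^{1,0}`.
  have hker : R.ker = ⊥ := by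
    rw [LinearMap.ker_eq_bot']
    rintro ⟨Z, hZ⟩ h
    obtain ⟨X, Y, rfl⟩ := exists_eq_re_add_im Z
    have hX : X = 0 := by
      rw [← reCT_re_add_im X Y]; exact h
    subst hX
    have hconj := conjCT_re_add_im (0 : TangentSpace (𝓡 (2 * n + 1)) x) Y
    have h0 := P.conj_disjoint x _ hZ (by
      rw [hconj]
      simpa using hZ)
    exact Subtype.ext h0
  have hrange : R.range = LinearMap.ker (P.θ x).toLinearMap := by
    refine Submodule.eq_of_le_of_finrank_eq ?_ ?_
    · rintro _ ⟨⟨Z, hZ⟩, rfl⟩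
      obtain ⟨X, Y, rfl⟩ := exists_eq_re_add_im Z
      have : R ⟨_, hZ⟩ = X := reCT_re_add_im X Y
      rw [this]
      exact (hθ X Y hZ).1
    · have h1 := R.finrank_range_add_finrank_ker
      rw [hker, finrank_bot, add_zero] at h1
      have h2 : Module.finrank ℝ ((P.T10 x).restrictScalars ℝ) = 2 * n := by
        have h := Module.finrank_mul_finrank ℝ ℂ (P.T10 x)
        rw [P.rank_eq, Complex.finrank_real_complex] at h
        exact h.symm
      have hne : (P.θ x).toLinearMap ≠ 0 := fun h =>
        P.θ_ne_zero x (ContinuousLinearMap.ext fun v => LinearMap.congr_fun h v)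
      have h3 := (P.θ x).toLinearMap.finrank_range_add_finrank_ker
      rw [LinearMap.range_eq_top.2 (LinearMap.surjective hne), finrank_top,
        Module.finrank_self] at h3
      have h4 : Module.finrank ℝ (TangentSpace (𝓡 (2 * n + 1)) x) = 2 * n + 1 := by
        change Module.finrank ℝ (CRModel n) = 2 * n + 1
        simp
      omega
  have hu' : u ∈ R.range := by rw [hrange]; exact hu
  obtain ⟨⟨Z, hZ⟩, hZu⟩ := hu'
  obtain ⟨X, Y, rfl⟩ := exists_eq_re_add_im Z
  have hX : X = u := (reCT_re_add_im X Y).symm.trans hZu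
  subst hX
  refine ⟨Y, (hθ X Y hZ).2, fun h0 => ?_⟩
  have hpos := P.levi_pos x _ hZ (by
    intro h
    apply hu0
    rw [← reCT_re_add_im X Y, h, map_zero])
  rw [OneForm.levi_self, h0] at hpos
  simp at hpos

/-- The form `θ ∧ (dθ)^n` does not vanish on a basis. -/
theorem volForm_basis_ne_zero
    (b : Module.Basis (Fin (2 * n + 1)) ℝ (TangentSpace (𝓡 (2 * n + 1)) x)) :
    P.θ.volForm x b ≠ 0 := by
  have := finiteDimensional_tangentSpace (n := n) x
  refine mul_ne_zero (by positivity) ?_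
  exact sum_sign_mul_ne_zero_of_basis (P.θ x).toLinearMap
    (fun h => P.θ_ne_zero x (ContinuousLinearMap.ext fun v => LinearMap.congr_fun h v))
    (P.θ.d x) (P.θ.d_swap x) (fun u hu hu0 => P.exists_d_ne_zero u hu hu0) b

/-- The Gram matrix of the Levi form on a family of `(1,0)`-vectors. -/
def leviGram (Z : Fin n → P.T10 x) : Matrix (Fin n) (Fin n) ℂ :=
  Matrix.of fun α β => P.θ.levi x (Z α) (Z β)

theorem posDef_leviGram {Z : Fin n → P.T10 x} (hZ : LinearIndependent ℂ Z) :
    (P.leviGram Z).PosDef := by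
  refine Matrix.PosDef.of_dotProduct_mulVec_pos ?_ fun c hc => ?_
  · ext α β
    simp [leviGram, Matrix.conjTranspose_apply, OneForm.conj_levi]
  · have hmem : (∑ α, conj (c α) • Z α : P.T10 x) ≠ 0 := by
      intro h0
      apply hc
      have := Fintype.linearIndependent_iff.1 hZ _ h0
      ext α
      simpa using this α
    have hval : star c ⬝ᵥ P.leviGram Z *ᵥ c =
        P.θ.levi x (∑ α, conj (c α) • Z α : P.T10 x) (∑ α, conj (c α) • Z α : P.T10 x) := by
      simp only [Submodule.coe_sum, Submodule.coe_smul, OneForm.levi_sum_left]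
      simp only [OneForm.levi_sum_right, dotProduct, mulVec, leviGram, Matrix.of_apply,
        Complex.conj_conj]
      simp [mul_comm]
    have hpos := P.levi_pos x _ (∑ α, conj (c α) • Z α : P.T10 x).2
      (fun h => hmem (Subtype.ext h))
    have him : (P.θ.levi x (∑ α, conj (c α) • Z α : P.T10 x)
        (∑ α, conj (c α) • Z α : P.T10 x)).im = 0 :=
      Complex.conj_eq_iff_im.1 (P.θ.conj_levi _ _)
    rw [hval, Complex.pos_iff]
    exact ⟨hpos, him.symm⟩

/-- The components of a `(0,1)`-covector on the conjugates of a family of `(1,0)`-vectors. -/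
def components (Z : Fin n → P.T10 x) (σ : Module.Dual ℂ (P.T01 x)) : Fin n → ℂ :=
  fun α => σ (P.bar (Z α))

theorem inner01_eq_dotProduct (σ τ : Module.Dual ℂ (P.T01 x)) :
    P.inner01 σ τ = P.components (P.frame x) σ ⬝ᵥ
      ((P.leviGram (P.frame x))⁻¹ *ᵥ star (P.components (P.frame x) τ)) := by
  simp only [inner01, dotProduct, mulVec, Finset.mul_sum, components, Pi.star_apply]
  refine Finset.sum_congr rfl fun α _ => Finset.sum_congr rfl fun β _ => ?_
  change (P.leviGram (P.frame x))⁻¹ α β * _ * _ = _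
  rw [starRingEnd_apply]
  ring

theorem bar_sum_smul (c : Fin n → ℂ) (Z : Fin n → P.T10 x) :
    P.bar (∑ α, c α • Z α) = ∑ α, conj (c α) • P.bar (Z α) := by
  apply Subtype.ext
  simp [CRStructure.bar, map_sum, LinearMap.map_smulₛₗ]

/-- The dual inner product can be computed in an arbitrary basis of `T^{1,0}`. -/
theorem inner01_eq_of_basis (Z : Module.Basis (Fin n) ℂ (P.T10 x))
    (σ τ : Module.Dual ℂ (P.T01 x)) :
    P.inner01 σ τ = P.components Z σ ⬝ᵥ ((P.leviGram Z)⁻¹ *ᵥ star (P.components Z τ)) := by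
  let F := P.frame x
  let A : Matrix (Fin n) (Fin n) ℂ := (F.toMatrix Z)ᵀ
  let B : Matrix (Fin n) (Fin n) ℂ := (Z.toMatrix F)ᵀ
  have hBA : B * A = 1 := by
    rw [← Matrix.transpose_mul, F.toMatrix_mul_toMatrix_flip, Matrix.transpose_one]
  have hAB : A * B = 1 := by
    rw [← Matrix.transpose_mul, Z.toMatrix_mul_toMatrix_flip, Matrix.transpose_one]
  have hZ (α : Fin n) : Z α = ∑ γ, A α γ • F γ := by
    rw [← F.sum_toMatrix_smul_self Z α]; rfl
  have hcomp (ρ : Module.Dual ℂ (P.T01 x)) :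
      P.components Z ρ = P.components F ρ ᵥ* Aᴴ := by
    ext α
    simp only [components, vecMul, dotProduct, conjTranspose_apply]
    rw [hZ α, bar_sum_smul, map_sum]
    exact Finset.sum_congr rfl fun γ _ => by rw [map_smul, smul_eq_mul, mul_comm]; rfl
  have hstar (ρ : Module.Dual ℂ (P.T01 x)) :
      star (P.components Z ρ) = A *ᵥ star (P.components F ρ) := by
    rw [hcomp, star_vecMul, conjTranspose_conjTranspose]
  have hgram : P.leviGram Z = A * P.leviGram F * Aᴴ := by
    ext α β
    simp only [leviGram, Matrix.of_apply, mul_apply, conjTranspose_apply, Finset.sum_mul]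
    rw [hZ α, hZ β]
    simp only [Submodule.coe_sum, Submodule.coe_smul, OneForm.levi_sum_left]
    simp only [OneForm.levi_sum_right, Finset.mul_sum]
    rw [Finset.sum_comm]
    refine Finset.sum_congr rfl fun γ _ => Finset.sum_congr rfl fun δ _ => ?_
    rw [starRingEnd_apply]
    ring
  have hAinv : A⁻¹ = B := Matrix.inv_eq_right_inv hAB
  rw [P.inner01_eq_dotProduct, hcomp, hstar, hgram, Matrix.mul_inv_rev, Matrix.mul_inv_rev,
    ← conjTranspose_nonsing_inv, hAinv, ← dotProduct_mulVec, mulVec_mulVec, mulVec_mulVec]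
  congr 2
  rw [← Matrix.mul_assoc, ← Matrix.mul_assoc, ← conjTranspose_mul, hBA, conjTranspose_one,
    Matrix.one_mul, Matrix.mul_assoc, hBA, Matrix.mul_one]

theorem posDef_leviMatrix_inv : ((P.leviGram (P.frame x))⁻¹).PosDef :=
  (P.posDef_leviGram (P.frame x).linearIndependent).inv

theorem inner01_add_left (σ σ' τ : Module.Dual ℂ (P.T01 x)) :
    P.inner01 (σ + σ') τ = P.inner01 σ τ + P.inner01 σ' τ := by
  simp only [inner01, LinearMap.add_apply, mul_add, add_mul, Finset.sum_add_distrib]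

theorem inner01_smul_left (c : ℂ) (σ τ : Module.Dual ℂ (P.T01 x)) :
    P.inner01 (c • σ) τ = c * P.inner01 σ τ := by
  simp only [inner01, LinearMap.smul_apply, smul_eq_mul, Finset.mul_sum]
  refine Finset.sum_congr rfl fun α _ => Finset.sum_congr rfl fun β _ => ?_
  ring

theorem inner01_sum_left {ι : Type*} (s : Finset ι) (σ : ι → Module.Dual ℂ (P.T01 x))
    (τ : Module.Dual ℂ (P.T01 x)) :
    P.inner01 (∑ i ∈ s, σ i) τ = ∑ i ∈ s, P.inner01 (σ i) τ := by
  classical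
  induction s using Finset.induction_on with
  | empty => simp [inner01]
  | insert a s ha ih => rw [Finset.sum_insert ha, Finset.sum_insert ha, inner01_add_left, ih]

theorem conj_inner01 (σ τ : Module.Dual ℂ (P.T01 x)) :
    conj (P.inner01 σ τ) = P.inner01 τ σ := by
  have hH := P.posDef_leviMatrix_inv (x := x).isHermitian
  simp only [inner01, map_sum, map_mul, Complex.conj_conj]
  rw [Finset.sum_comm]
  refine Finset.sum_congr rfl fun α _ => Finset.sum_congr rfl fun β _ => ?_
  have : conj ((P.leviMatrix x)⁻¹ β α) = (P.leviMatrix x)⁻¹ α β := congrFun (congrFun hH α) β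
  rw [this]
  ring

theorem inner01_add_right (σ τ τ' : Module.Dual ℂ (P.T01 x)) :
    P.inner01 σ (τ + τ') = P.inner01 σ τ + P.inner01 σ τ' := by
  rw [← conj_inner01, inner01_add_left, map_add, conj_inner01, conj_inner01]

theorem inner01_smul_right (c : ℂ) (σ τ : Module.Dual ℂ (P.T01 x)) :
    P.inner01 σ (c • τ) = conj c * P.inner01 σ τ := by
  rw [← conj_inner01, inner01_smul_left, map_mul, conj_inner01]

theorem normSq01_nonneg (σ : Module.Dual ℂ (P.T01 x)) : 0 ≤ P.normSq01 σ := by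
  have h := P.posDef_leviMatrix_inv (x := x).posSemidef.dotProduct_mulVec_nonneg
    (star (P.components (P.frame x) σ))
  rw [star_star, ← inner01_eq_dotProduct] at h
  exact (Complex.nonneg_iff.1 h).1

theorem inner01_self (σ : Module.Dual ℂ (P.T01 x)) : P.inner01 σ σ = (P.normSq01 σ : ℂ) :=
  (Complex.conj_eq_iff_re.1 (P.conj_inner01 σ σ)).symm

/-- The polarization identity for `Re ⟨σ, σ + τ⟩`. -/
theorem re_inner01_add (σ τ : Module.Dual ℂ (P.T01 x)) :
    (P.inner01 σ (σ + τ)).re =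
      (P.normSq01 σ - P.normSq01 τ + P.normSq01 (σ + τ)) / 2 := by
  have h : (P.inner01 τ σ).re = (P.inner01 σ τ).re := by rw [← conj_inner01, Complex.conj_re]
  simp only [normSq01, inner01_add_right, inner01_add_left, Complex.add_re, h]
  ring

/-- Conjugate covectors have the same length. -/
theorem normSq10_eq_normSq01 (η : Module.Dual ℂ (P.T10 x)) (τ : Module.Dual ℂ (P.T01 x))
    (h : ∀ Z : P.T10 x, τ (P.bar Z) = conj (η Z)) : P.normSq10 η = P.normSq01 τ := by
  rw [normSq10, normSq01, inner10, inner01]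
  congr 1
  rw [Finset.sum_comm]
  refine Finset.sum_congr rfl fun α _ => Finset.sum_congr rfl fun β _ => ?_
  rw [h, h, Complex.conj_conj]
  ring

end PseudohermitianStructure

/-! ### Differentials of complex-valued functions -/

section ComplexDifferential

variable {n : ℕ} {M : Type*} [TopologicalSpace M] [ChartedSpace (CRModel n) M]
  {f g : M → ℂ}

theorem SmoothFun.mdifferentiableAt (hf : SmoothFun n f) (x : M) :
    MDifferentiableAt (𝓡 (2 * n + 1)) 𝓘(ℝ, ℂ) f x :=
  ContMDiff.mdifferentiableAt hf (by simp)

theorem SmoothFun.continuous (hf : SmoothFun n f) : Continuous f :=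
  ContMDiff.continuous hf

theorem SmoothFun.const (c : ℂ) : SmoothFun n (fun _ : M => c) := contMDiff_const

theorem SmoothFun.add (hf : SmoothFun n f) (hg : SmoothFun n g) :
    SmoothFun n (fun x => f x + g x) := ContMDiff.add hf hg

theorem SmoothFun.mul (hf : SmoothFun n f) (hg : SmoothFun n g) :
    SmoothFun n (fun x => f x * g x) := 
  (contDiff_mul (𝕜 := ℝ)).contMDiff.comp (ContMDiff.prodMk_space hf hg)

theorem SmoothFun.conj (hf : SmoothFun n f) : SmoothFun n (fun x => conj (f x)) :=
  (Complex.conjCLE.contDiff.contMDiff).comp hf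

theorem SmoothFun.sum {ι : Type*} {s : Finset ι} {F : ι → M → ℂ} (hF : ∀ i, SmoothFun n (F i)) :
    SmoothFun n (fun x => ∑ i ∈ s, F i x) :=
  contMDiff_finsetSum fun i _ => hF i

variable (n) in
/-- The real differential of a complex-valued function, with the tangent space read as the model
space. -/
def realDiff (f : M → ℂ) (x : M) : CRModel n →L[ℝ] ℂ :=
  mfderiv (𝓡 (2 * n + 1)) 𝓘(ℝ, ℂ) f x

theorem complexDiff_re_add_im (f : M → ℂ) (x : M) (X Y : TangentSpace (𝓡 (2 * n + 1)) x) :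
    complexDiff n f x ((1 : ℂ) ⊗ₜ[ℝ] X + Complex.I ⊗ₜ[ℝ] Y) =
      realDiff n f x X + Complex.I * realDiff n f x Y := by
  rw [map_add, complexDiff, LinearMap.liftBaseChange_tmul, LinearMap.liftBaseChange_tmul, one_smul,
    smul_eq_mul]
  rfl

theorem complexDiff_add (hf : SmoothFun n f) (hg : SmoothFun n g) (x : M) :
    complexDiff n (fun y => f y + g y) x = complexDiff n f x + complexDiff n g x := by
  have h : realDiff n (fun y => f y + g y) x = realDiff n f x + realDiff n g x :=
    mfderiv_add (hf.mdifferentiableAt x) (hg.mdifferentiableAt x)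
  have h' (W : CRModel n) : realDiff n (fun y => f y + g y) x W =
      realDiff n f x W + realDiff n g x W := by rw [h]; rfl
  refine LinearMap.ext fun Z => ?_
  obtain ⟨X, Y, rfl⟩ := exists_eq_re_add_im Z
  rw [LinearMap.add_apply, complexDiff_re_add_im, complexDiff_re_add_im, complexDiff_re_add_im,
    h' X, h' Y]
  ring

theorem complexDiff_const (c : ℂ) (x : M) : complexDiff n (fun _ : M => c) x = 0 := by
  have h : realDiff n (fun _ : M => c) x = 0 := mfderiv_const
  have h' (W : CRModel n) : realDiff n (fun _ : M => c) x W = 0 := by rw [h]; rfl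
  refine LinearMap.ext fun Z => ?_
  obtain ⟨X, Y, rfl⟩ := exists_eq_re_add_im Z
  rw [complexDiff_re_add_im, h' X, h' Y, mul_zero, add_zero, LinearMap.zero_apply]

theorem complexDiff_mul (hf : SmoothFun n f) (hg : SmoothFun n g) (x : M) :
    complexDiff n (fun y => f y * g y) x = f x • complexDiff n g x + g x • complexDiff n f x := by
  have h : realDiff n (fun y => f y * g y) x = f x • realDiff n g x + g x • realDiff n f x :=
    ((hf.mdifferentiableAt x).hasMFDerivAt.mul (hg.mdifferentiableAt x).hasMFDerivAt).mfderiv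
  have h' (W : CRModel n) : realDiff n (fun y => f y * g y) x W =
      f x * realDiff n g x W + g x * realDiff n f x W := by rw [h]; rfl
  refine LinearMap.ext fun Z => ?_
  obtain ⟨X, Y, rfl⟩ := exists_eq_re_add_im Z
  rw [LinearMap.add_apply, LinearMap.smul_apply, LinearMap.smul_apply, complexDiff_re_add_im,
    complexDiff_re_add_im, complexDiff_re_add_im, h' X, h' Y, smul_eq_mul, smul_eq_mul]
  ring

theorem complexDiff_sum {ι : Type*} (s : Finset ι) {F : ι → M → ℂ}
    (hF : ∀ i, SmoothFun n (F i)) (x : M) :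
    complexDiff n (fun y => ∑ i ∈ s, F i y) x = ∑ i ∈ s, complexDiff n (F i) x := by
  classical
  induction s using Finset.induction_on with
  | empty => simpa using complexDiff_const (n := n) 0 x
  | insert a s ha ih =>
    simp only [Finset.sum_insert ha]
    rw [complexDiff_add (hF a) (SmoothFun.sum hF), ih]

theorem complexDiff_conj (hf : SmoothFun n f) (x : M) (Z : CTangent n x) :
    complexDiff n (fun y => conj (f y)) x (conjCT x Z) = conj (complexDiff n f x Z) := by
  have h : realDiff n (fun y => conj (f y)) x =
      (Complex.conjCLE : ℂ →L[ℝ] ℂ).comp (realDiff n f x) := by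
    have h1 := mfderiv_comp (I' := 𝓘(ℝ, ℂ)) (I'' := 𝓘(ℝ, ℂ)) x
      (Complex.conjCLE.differentiable (f x)).mdifferentiableAt (hf.mdifferentiableAt x)
    rw [mfderiv_eq_fderiv, Complex.conjCLE.fderiv] at h1
    exact h1
  obtain ⟨X, Y, rfl⟩ := exists_eq_re_add_im Z
  have hc : conjCT x ((1 : ℂ) ⊗ₜ[ℝ] X + Complex.I ⊗ₜ[ℝ] Y) =
      (1 : ℂ) ⊗ₜ[ℝ] X + Complex.I ⊗ₜ[ℝ] (-Y) := by
    rw [conjCT_re_add_im, TensorProduct.tmul_neg, sub_eq_add_neg]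
  rw [hc, complexDiff_re_add_im, complexDiff_re_add_im, h]
  have hneg : ((Complex.conjCLE : ℂ →L[ℝ] ℂ).comp (realDiff n f x)) (-Y) =
    -conj (realDiff n f x Y) := map_neg _ _
  have hX : ((Complex.conjCLE : ℂ →L[ℝ] ℂ).comp (realDiff n f x)) X =
    conj (realDiff n f x X) := rfl
  rw [hneg, hX, map_add, map_mul, Complex.conj_I]
  ring

end ComplexDifferential

/-! ### Continuity of the dual inner product of differentials -/

section Continuity

variable {n : ℕ} {M : Type*} [TopologicalSpace M] [ChartedSpace (CRModel n) M]
  [IsManifold (𝓡 (2 * n + 1)) ∞ M]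
  {X Y : ∀ x : M, TangentSpace (𝓡 (2 * n + 1)) x} {U : Set M}

theorem SmoothFieldOn.continuousAt_realDiff {f : M → ℂ} (hf : SmoothFun n f)
    (hX : SmoothFieldOn X U) {x₀ : M} (hU : U ∈ nhds x₀) :
    ContinuousAt (fun x => realDiff n f x (X x)) x₀ := by
  have h1 := ContMDiff.contMDiff_tangentMap (m := 0) hf (by simp)
  have h2 : ContinuousAt (fun p : TangentBundle 𝓘(ℝ, ℂ) ℂ => (p.2 : ℂ))
      (tangentMap (𝓡 (2 * n + 1)) 𝓘(ℝ, ℂ) f ⟨x₀, X x₀⟩) :=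
    (contMDiff_snd_tangentBundle_modelSpace (n := 0) ℂ 𝓘(ℝ, ℂ)).continuous.continuousAt
  have h3 : ContinuousAt (fun x => (⟨x, X x⟩ : TangentBundle (𝓡 (2 * n + 1)) M)) x₀ :=
    (ContMDiffOn.continuousOn hX).continuousAt hU
  exact ContinuousAt.comp (f := fun x => tangentMap (𝓡 (2 * n + 1)) 𝓘(ℝ, ℂ) f ⟨x, X x⟩) h2
    (ContinuousAt.comp (f := fun x => (⟨x, X x⟩ : TangentBundle (𝓡 (2 * n + 1)) M))
      h1.continuous.continuousAt h3)

/-- The coordinate expression of a smooth vector field in the chart at `x₀` is its expression in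
the trivialization of the tangent bundle at `x₀`. -/
theorem SmoothFieldOn.continuousAt_chartDeriv (hX : SmoothFieldOn X U) {x₀ : M}
    (hU : U ∈ nhds x₀) : ContinuousAt (fun x => chartDeriv x₀ x (X x)) x₀ := by
  have := isManifold_one n M
  have h1 := (Bundle.contMDiffAt_section x₀).1 (ContMDiffOn.contMDiffAt hX hU)
  refine h1.continuousAt.congr ?_
  filter_upwards [(chartAt (CRModel n) x₀).open_source.mem_nhds (mem_chart_source _ x₀)] with x hx
  have h2 := TangentBundle.continuousLinearMapAt_trivializationAt (I := 𝓡 (2 * n + 1)) hx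
  have h3 : chartDeriv x₀ x (X x) = (trivializationAt (CRModel n)
      (TangentSpace (𝓡 (2 * n + 1))) x₀).continuousLinearMapAt ℝ x (X x) := by rw [h2]; rfl
  rw [h3, Bundle.Trivialization.continuousLinearMapAt_apply,
    Bundle.Trivialization.linearMapAt_apply, if_pos (by simpa using! hx)]

theorem OneForm.Smooth.continuousAt_d {θ : OneForm n M} (h : θ.Smooth) (hX : SmoothFieldOn X U)
    (hY : SmoothFieldOn Y U) {x₀ : M} (hU : U ∈ nhds x₀) :
    ContinuousAt (fun x => θ.d x (X x) (Y x)) x₀ := by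
  have hmem := (isOpen_extChartAt_source (I := 𝓡 (2 * n + 1)) x₀).mem_nhds
    (mem_extChartAt_source x₀)
  have hD : ContinuousAt (fun x => fderiv ℝ (θ.inChart x₀) (extChartAt (𝓡 (2 * n + 1)) x₀ x))
      x₀ := by
    have h1 := (h.contDiffOn_inChart x₀).contDiffAt (extChartAt_target_mem_nhds x₀)
    exact ContinuousAt.comp (f := extChartAt (𝓡 (2 * n + 1)) x₀)
      (h1.fderiv_right (m := 0) (by simp)).continuousAt (continuousAt_extChartAt x₀)
  have hX' := hX.continuousAt_chartDeriv hU
  have hY' := hY.continuousAt_chartDeriv hU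
  refine (((hD.clm_apply hX').clm_apply hY').sub ((hD.clm_apply hY').clm_apply hX')).congr ?_
  filter_upwards [hmem] with x hx
  rw [h.d_eq_inChart hx]
  rfl

namespace PseudohermitianStructure

open Matrix
open scoped ComplexOrder

variable (P : PseudohermitianStructure n M)

/-- The function `⟨∂̄_b f, ∂̄_b g⟩` is continuous: it can be computed in smooth local frames. -/
theorem continuous_inner01_delbar {f g : M → ℂ} (hf : SmoothFun n f) (hg : SmoothFun n g) :
    Continuous fun x => P.inner01 (P.delbar f x) (P.delbar g x) := by
  rw [continuous_iff_continuousAt]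
  intro x₀
  obtain ⟨U, hUo, hx₀, X, Y, hXY, hspan⟩ := P.smooth_frame x₀
  have hU := hUo.mem_nhds hx₀
  let G : M → Matrix (Fin n) (Fin n) ℂ := fun x => Matrix.of fun α β =>
    ((P.θ.d x (Y α x) (X β x) - P.θ.d x (X α x) (Y β x) : ℝ) : ℂ) -
      ((P.θ.d x (X α x) (X β x) + P.θ.d x (Y α x) (Y β x) : ℝ) : ℂ) * Complex.I
  let a : (M → ℂ) → M → Fin n → ℂ := fun f x α =>
    realDiff n f x (X α x) - Complex.I * realDiff n f x (Y α x)
  have hmem (x : M) (hx : x ∈ U) (α : Fin n) : complexField (X α) (Y α) x ∈ P.T10 x := by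
    rw [← hspan x hx]
    exact Submodule.subset_span ⟨α, rfl⟩
  have hbasis (x : M) (hx : x ∈ U) : ∃ Z : Module.Basis (Fin n) ℂ (P.T10 x),
      ∀ α, (Z α : CTangent n x) = complexField (X α) (Y α) x := by
    let Z : Fin n → P.T10 x := fun α => ⟨_, hmem x hx α⟩
    have htop : ⊤ ≤ Submodule.span ℂ (Set.range Z) := by
      rintro ⟨W, hW⟩ -
      have hmap : (Submodule.span ℂ (Set.range Z)).map (P.T10 x).subtype = P.T10 x := by
        rw [Submodule.map_span, ← Set.range_comp]
        exact hspan x hx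
      have hW' := hW
      rw [← hmap] at hW'
      obtain ⟨W', hW1, hW2⟩ := hW'
      rwa [show (⟨W, hW⟩ : P.T10 x) = W' from Subtype.ext hW2.symm]
    refine ⟨basisOfTopLeSpanOfCardEqFinrank Z htop (by simp [P.rank_eq]), fun α => ?_⟩
    rw [coe_basisOfTopLeSpanOfCardEqFinrank]
  have hG (x : M) (Z : Module.Basis (Fin n) ℂ (P.T10 x))
      (hZ : ∀ α, (Z α : CTangent n x) = complexField (X α) (Y α) x) : P.leviGram Z = G x := by
    ext α β
    simp only [leviGram, Matrix.of_apply, G]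
    rw [hZ, hZ, complexField, complexField, OneForm.levi_re_add_im]
  have ha (f : M → ℂ) (x : M) (Z : Module.Basis (Fin n) ℂ (P.T10 x))
      (hZ : ∀ α, (Z α : CTangent n x) = complexField (X α) (Y α) x) :
      P.components Z (P.delbar f x) = a f x := by
    ext α
    change complexDiff n f x (conjCT x (Z α)) = a f x α
    rw [hZ, complexField, conjCT_re_add_im, sub_eq_add_neg, ← TensorProduct.tmul_neg,
      complexDiff_re_add_im]
    have : realDiff n f x (-Y α x) = -realDiff n f x (Y α x) := map_neg _ _
    rw [this, mul_neg, ← sub_eq_add_neg]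
  have hacont (f : M → ℂ) (hf : SmoothFun n f) : ContinuousAt (a f) x₀ := by
    rw [continuousAt_pi]
    intro α
    exact ((hXY α).1.continuousAt_realDiff hf hU).sub
      (continuousAt_const.mul ((hXY α).2.continuousAt_realDiff hf hU))
  have hGcont : ContinuousAt G x₀ := by
    refine continuousAt_pi.2 fun α => continuousAt_pi.2 fun β => ?_
    have h1 := P.smooth_θ.continuousAt_d (hXY α).2 (hXY β).1 hU
    have h2 := P.smooth_θ.continuousAt_d (hXY α).1 (hXY β).2 hU
    have h3 := P.smooth_θ.continuousAt_d (hXY α).1 (hXY β).1 hU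
    have h4 := P.smooth_θ.continuousAt_d (hXY α).2 (hXY β).2 hU
    exact (Complex.continuous_ofReal.continuousAt.comp (h1.sub h2)).sub
      ((Complex.continuous_ofReal.continuousAt.comp (h3.add h4)).mul continuousAt_const)
  have hdet : (G x₀).det ≠ 0 := by
    obtain ⟨Z, hZ⟩ := hbasis x₀ hx₀
    rw [← hG x₀ Z hZ]
    exact ((Matrix.isUnit_iff_isUnit_det _).1 (P.posDef_leviGram Z.linearIndependent).isUnit).ne_zero
  have hGinv : ContinuousAt (fun x => (G x)⁻¹) x₀ := by
    refine ContinuousAt.comp (f := G) (continuousAt_matrix_inv _ ?_) hGcont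
    rw [Ring.inverse_eq_inv']
    exact continuousAt_inv₀ hdet
  have hmain : ContinuousAt (fun x => a f x ⬝ᵥ ((G x)⁻¹ *ᵥ star (a g x))) x₀ := by
    have hF : Continuous fun p : (Fin n → ℂ) × Matrix (Fin n) (Fin n) ℂ × (Fin n → ℂ) =>
        p.1 ⬝ᵥ (p.2.1 *ᵥ star p.2.2) := by fun_prop
    exact ContinuousAt.comp (f := fun x => (a f x, (G x)⁻¹, a g x)) hF.continuousAt
      ((hacont f hf).prodMk (hGinv.prodMk (hacont g hg)))
  refine hmain.congr ?_
  filter_upwards [hU] with x hx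
  obtain ⟨Z, hZ⟩ := hbasis x hx
  rw [P.inner01_eq_of_basis Z, ha f x Z hZ, ha g x Z hZ, hG x Z hZ]

end PseudohermitianStructure

end Continuity

/-! ### The measure of the volume form -/

namespace PseudohermitianStructure

open MeasureTheory

variable {n : ℕ} {M : Type*} [TopologicalSpace M] [ChartedSpace (CRModel n) M]
  [IsManifold (𝓡 (2 * n + 1)) ∞ M] (P : PseudohermitianStructure n M)

/-- The coefficient of `θ ∧ (dθ)^n` with respect to the coordinates of the chart at `c`. -/
def chartDensity (c : M) (y : CRModel n) : ℝ :=
  P.θ.volForm ((extChartAt (𝓡 (2 * n + 1)) c).symm y)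
    (fun i => mfderiv 𝓘(ℝ, CRModel n) (𝓡 (2 * n + 1)) (extChartAt (𝓡 (2 * n + 1)) c).symm y
      (EuclideanSpace.single i (1 : ℝ)))

variable {c : M}

theorem chartDeriv_chartSymmDeriv {y : CRModel n}
    (hy : y ∈ (extChartAt (𝓡 (2 * n + 1)) c).target) (v : CRModel n) :
    chartDeriv c ((extChartAt (𝓡 (2 * n + 1)) c).symm y) (chartSymmDeriv c y v) = v := by
  have h := chartDeriv_comp_chartSymmDeriv hy ((extChartAt (𝓡 (2 * n + 1)) c).map_target hy)
  have hid : (chartTransition c c : CRModel n → CRModel n) =ᶠ[nhds y] id := by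
    filter_upwards [(isOpen_extChartAt_target (I := 𝓡 (2 * n + 1)) c).mem_nhds hy] with z hz
    exact (extChartAt (𝓡 (2 * n + 1)) c).right_inv hz
  rw [hid.fderiv_eq, fderiv_id] at h
  exact DFunLike.congr_fun h v

theorem chartDensity_ne_zero {y : CRModel n}
    (hy : y ∈ (extChartAt (𝓡 (2 * n + 1)) c).target) : P.chartDensity c y ≠ 0 := by
  have hinj : Function.Injective (chartSymmDeriv c y) :=
    Function.LeftInverse.injective (chartDeriv_chartSymmDeriv hy)
  let e : CRModel n ≃ₗ[ℝ] CRModel n :=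
    LinearEquiv.ofInjectiveEndo (chartSymmDeriv c y).toLinearMap hinj
  let b : Module.Basis (Fin (2 * n + 1)) ℝ (CRModel n) :=
    (EuclideanSpace.basisFun (Fin (2 * n + 1)) ℝ).toBasis.map e
  have h := P.volForm_basis_ne_zero (x := (extChartAt (𝓡 (2 * n + 1)) c).symm y) b
  have hb (i) : b i = chartSymmDeriv c y (EuclideanSpace.single i (1 : ℝ)) := by
    simp [b, e]
  have hb' : (b : Fin (2 * n + 1) → CRModel n) = fun i =>
    chartSymmDeriv c y (EuclideanSpace.single i (1 : ℝ)) := funext hb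
  intro h0
  apply h
  rw [← h0]
  exact congrArg (P.θ.volForm ((extChartAt (𝓡 (2 * n + 1)) c).symm y)) hb'

theorem continuousOn_chartDensity (c : M) :
    ContinuousOn (P.chartDensity c) (extChartAt (𝓡 (2 * n + 1)) c).target := by
  let E : Fin (2 * n + 1) → CRModel n := fun i => EuclideanSpace.single i (1 : ℝ)
  have hsmooth := P.smooth_θ.contDiffOn_inChart c
  have h0 : ContinuousOn (P.θ.inChart c) (extChartAt (𝓡 (2 * n + 1)) c).target :=
    hsmooth.continuousOn
  have h1 : ContinuousOn (fderiv ℝ (P.θ.inChart c)) (extChartAt (𝓡 (2 * n + 1)) c).target :=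
    hsmooth.continuousOn_fderiv_of_isOpen (isOpen_extChartAt_target c) (by simp)
  have hskew (i j : Fin (2 * n + 1)) : ContinuousOn
      (fun y => skewForm (fderiv ℝ (P.θ.inChart c) y) (E i) (E j))
      (extChartAt (𝓡 (2 * n + 1)) c).target := by
    exact ((h1.clm_apply continuousOn_const).clm_apply continuousOn_const).sub
      ((h1.clm_apply continuousOn_const).clm_apply continuousOn_const)
  have hpoly : ContinuousOn (fun y => ((2 : ℝ) ^ n)⁻¹ * ∑ σ : Equiv.Perm (Fin (2 * n + 1)),
      ((Equiv.Perm.sign σ : ℤ) : ℝ) * (P.θ.inChart c y (E (σ 0)) *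
      ∏ i : Fin n, skewForm (fderiv ℝ (P.θ.inChart c) y) (E (σ ⟨2 * (i : ℕ) + 1, by omega⟩))
        (E (σ ⟨2 * (i : ℕ) + 2, by omega⟩)))) (extChartAt (𝓡 (2 * n + 1)) c).target := by
    refine continuousOn_const.mul (continuousOn_finsetSum _ fun σ _ => continuousOn_const.mul ?_)
    exact (h0.clm_apply continuousOn_const).mul (continuousOn_finsetProd _ fun i _ => hskew _ _)
  refine hpoly.congr fun y hy => ?_
  rw [chartDensity, OneForm.volForm]
  congr 1
  refine Finset.sum_congr rfl fun σ _ => ?_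
  congr 2
  refine Finset.prod_congr rfl fun i _ => ?_
  rw [P.smooth_θ.d_eq_inChart ((extChartAt (𝓡 (2 * n + 1)) c).map_target hy),
    (extChartAt (𝓡 (2 * n + 1)) c).right_inv hy]
  congr 1
  · congr 1
    exact chartDeriv_chartSymmDeriv hy _
  · exact chartDeriv_chartSymmDeriv hy _

variable [T2Space M] [CompactSpace M] [MeasurableSpace M] [BorelSpace M]

omit [T2Space M] [CompactSpace M] [MeasurableSpace M] [BorelSpace M] in
theorem aemeasurable_ofReal_abs_chartDensity (c : M) :
    AEMeasurable (fun y => ENNReal.ofReal |P.chartDensity c y|)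
      (volume.restrict (extChartAt (𝓡 (2 * n + 1)) c).target) :=
  ((P.continuousOn_chartDensity c).abs.aemeasurable
    (isOpen_extChartAt_target c).measurableSet).ennreal_ofReal

omit [T2Space M] [CompactSpace M] [IsManifold (𝓡 (2 * n + 1)) ∞ M] in
theorem aemeasurable_extChartAt_symm (c : M) :
    AEMeasurable (extChartAt (𝓡 (2 * n + 1)) c).symm
      (volume.restrict (extChartAt (𝓡 (2 * n + 1)) c).target) :=
  (continuousOn_extChartAt_symm c).aemeasurable (isOpen_extChartAt_target c).measurableSet

theorem measurable_ofReal_chartPartition (c : M) :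
    Measurable fun x => ENNReal.ofReal (chartPartition n M c x) :=
  (chartPartition n M c).2.continuous.measurable.ennreal_ofReal

omit [MeasurableSpace M] [BorelSpace M] in
theorem chartPartition_isSubordinate :
    (chartPartition n M).IsSubordinate fun c : M => (chartAt (CRModel n) c).source :=
  (exists_chartPartition n M).choose_spec

/-- A chart contributes a finite measure, since the support of the function of the partition of
unity is a compact subset of the domain of the chart. -/
theorem withDensity_chartMeasure_univ_lt_top (c : M) :
    (P.θ.chartMeasure c).withDensity (fun x => ENNReal.ofReal (chartPartition n M c x))
      Set.univ < ⊤ := by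
  let φ := extChartAt (𝓡 (2 * n + 1)) c
  let K : Set (CRModel n) := φ '' tsupport (chartPartition n M c)
  have hsub : tsupport (chartPartition n M c) ⊆ φ.source := by
    have := chartPartition_isSubordinate (n := n) (M := M) c
    rwa [extChartAt_source]
  have hK : IsCompact K :=
    (isClosed_tsupport _).isCompact.image_of_continuousOn ((continuousOn_extChartAt c).mono hsub)
  have hKt : K ⊆ φ.target := by
    rintro _ ⟨x, hx, rfl⟩
    exact φ.map_source (hsub hx)
  obtain ⟨C, hC⟩ := hK.exists_bound_of_continuousOn ((P.continuousOn_chartDensity c).mono hKt)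
  rw [withDensity_apply _ MeasurableSet.univ, Measure.restrict_univ]
  have hmap : ∫⁻ x, ENNReal.ofReal (chartPartition n M c x) ∂P.θ.chartMeasure c ≤
      ∫⁻ y in φ.target, ENNReal.ofReal |P.chartDensity c y| *
        ENNReal.ofReal (chartPartition n M c (φ.symm y)) :=
    (lintegral_map_le _ _).trans
      (lintegral_withDensity_eq_lintegral_mul₀ (P.aemeasurable_ofReal_abs_chartDensity c)
        ((measurable_ofReal_chartPartition c).comp_aemeasurable
          (aemeasurable_extChartAt_symm c))).le
  refine hmap.trans_lt ?_
  have hbound : ∫⁻ y in φ.target, ENNReal.ofReal |P.chartDensity c y| *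
        ENNReal.ofReal (chartPartition n M c (φ.symm y)) ≤
      ∫⁻ y in φ.target, K.indicator (fun _ => ENNReal.ofReal C) y := by
    refine setLIntegral_mono_ae' (isOpen_extChartAt_target c).measurableSet
      (Filter.Eventually.of_forall fun y hy => ?_)
    by_cases hyK : y ∈ K
    · rw [Set.indicator_of_mem hyK]
      calc _ ≤ ENNReal.ofReal C * 1 := by
            gcongr
            · exact hC y hyK
            · exact ENNReal.ofReal_le_one.2 ((chartPartition n M).le_one c _)
        _ = _ := mul_one _
    · have h0 : chartPartition n M c (φ.symm y) = 0 := by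
        by_contra hne
        exact hyK ⟨φ.symm y, subset_tsupport _ hne, φ.right_inv hy⟩
      simp [h0]
  refine hbound.trans_lt ((setLIntegral_le_lintegral _ _).trans_lt ?_)
  rw [lintegral_indicator hK.measurableSet, setLIntegral_const]
  exact ENNReal.mul_lt_top ENNReal.ofReal_lt_top hK.measure_lt_top

/-- By compactness, only finitely many charts contribute to the measure. -/
instance isFiniteMeasure_vol : IsFiniteMeasure P.θ.vol := by
  refine ⟨?_⟩
  have hfin : {c : M | (Function.support (chartPartition n M c)).Nonempty}.Finite :=
    (chartPartition n M).locallyFinite.finite_nonempty_of_compact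
  rw [OneForm.vol, Measure.sum_apply _ MeasurableSet.univ,
    tsum_eq_sum (s := hfin.toFinset) fun c hc => ?_]
  · exact ENNReal.sum_lt_top.2 fun c _ => P.withDensity_chartMeasure_univ_lt_top c
  · have h0 : ∀ x, chartPartition n M c x = 0 := by
      intro x
      by_contra hne
      exact hc (hfin.mem_toFinset.2 ⟨x, hne⟩)
    simp [h0]

/-- Near a point where a function of the partition of unity is positive, the corresponding chart
already contributes positive measure. -/
instance isOpenPosMeasure_vol : P.θ.vol.IsOpenPosMeasure := by
  refine ⟨fun U hU hne => ?_⟩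
  obtain ⟨x, hx⟩ := hne
  obtain ⟨c, hc⟩ := (chartPartition n M).exists_pos_of_mem (Set.mem_univ x)
  let φ := extChartAt (𝓡 (2 * n + 1)) c
  have hxs : x ∈ φ.source := by
    rw [extChartAt_source]
    exact chartPartition_isSubordinate c (subset_tsupport _ hc.ne')
  let W : Set M := {z | ENNReal.ofReal (chartPartition n M c z) ≠ 0} ∩ U
  have hWo : IsOpen W := by
    refine IsOpen.inter ?_ hU
    have : {z | ENNReal.ofReal (chartPartition n M c z) ≠ 0} =
        {z | 0 < chartPartition n M c z} := by
      ext z; simp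
    rw [this]
    exact isOpen_lt continuous_const (chartPartition n M c).2.continuous
  have hWx : x ∈ W := ⟨by simpa using hc, hx⟩
  intro h0
  rw [OneForm.vol, Measure.sum_apply _ hU.measurableSet, ENNReal.tsum_eq_zero] at h0
  have h1 := h0 c
  rw [withDensity_apply_eq_zero (measurable_ofReal_chartPartition c)] at h1
  have hac : (volume.restrict φ.target).withDensity
      (fun y => ENNReal.ofReal |P.chartDensity c y|) ≪ volume.restrict φ.target :=
    withDensity_absolutelyContinuous _ _
  have h2 : (volume.restrict φ.target).withDensity
      (fun y => ENNReal.ofReal |P.chartDensity c y|) (φ.symm ⁻¹' W) = 0 := by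
    rw [← Measure.map_apply_of_aemeasurable
      ((aemeasurable_extChartAt_symm c).mono_ac hac) hWo.measurableSet]
    exact h1
  rw [withDensity_apply_eq_zero' (P.aemeasurable_ofReal_abs_chartDensity c)] at h2
  have h3 : volume (φ.target ∩ φ.symm ⁻¹' W) = 0 := by
    refine measure_mono_null ?_ (Measure.measure_inter_eq_zero_of_restrict h2)
    rintro y ⟨hy, hyW⟩
    exact ⟨⟨by simpa using P.chartDensity_ne_zero hy, hyW⟩, hy⟩
  have hopen : IsOpen (φ.target ∩ φ.symm ⁻¹' W) :=
    (continuousOn_extChartAt_symm c).isOpen_inter_preimage (isOpen_extChartAt_target c) hWo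
  refine (hopen.measure_pos volume ⟨φ x, φ.map_source hxs, ?_⟩).ne' h3
  rw [Set.mem_preimage, φ.left_inv hxs]
  exact hWx

end PseudohermitianStructure

/-! ### The integral identity -/

namespace PseudohermitianStructure

open MeasureTheory

variable {n : ℕ} {M : Type*} [TopologicalSpace M] [ChartedSpace (CRModel n) M]
  [IsManifold (𝓡 (2 * n + 1)) ∞ M] (P : PseudohermitianStructure n M) {f g : M → ℂ}

theorem delbar_mul (hf : SmoothFun n f) (hg : SmoothFun n g) (x : M) :
    P.delbar (fun y => f y * g y) x = f x • P.delbar g x + g x • P.delbar f x := by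
  simp only [CRStructure.delbar, complexDiff_mul hf hg]
  rfl

theorem delbar_add_const (hf : SmoothFun n f) (c : ℂ) (x : M) :
    P.delbar (fun y => f y + c) x = P.delbar f x := by
  simp only [CRStructure.delbar, complexDiff_add hf (SmoothFun.const c), complexDiff_const,
    add_zero]

theorem delbar_sum {ι : Type*} (s : Finset ι) {F : ι → M → ℂ} (hF : ∀ i, SmoothFun n (F i))
    (x : M) : P.delbar (fun y => ∑ i ∈ s, F i y) x = ∑ i ∈ s, P.delbar (F i) x := by
  simp only [CRStructure.delbar, complexDiff_sum s hF]
  ext Z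
  simp

theorem delbar_conj_bar (hf : SmoothFun n f) (x : M) (Z : P.T10 x) :
    P.delbar (fun y => conj (f y)) x (P.bar Z) = conj (P.del f x Z) :=
  complexDiff_conj hf x Z

theorem continuous_normSq01_sum {ι : Type*} (s : Finset ι) {a F : ι → M → ℂ}
    (ha : ∀ i, Continuous (a i)) (hF : ∀ i, SmoothFun n (F i)) :
    Continuous fun x => P.normSq01 (∑ i ∈ s, a i x • P.delbar (F i) x) := by
  have h (x : M) : P.normSq01 (∑ i ∈ s, a i x • P.delbar (F i) x) =
      (∑ i ∈ s, a i x * conj (∑ j ∈ s, a j x * P.inner01 (P.delbar (F j) x)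
        (P.delbar (F i) x))).re := by
    rw [normSq01, inner01_sum_left]
    congr 1
    refine Finset.sum_congr rfl fun i _ => ?_
    rw [inner01_smul_left, ← conj_inner01, inner01_sum_left]
    simp only [inner01_smul_left]
  simp only [h]
  refine Complex.continuous_re.comp (continuous_finsetSum _ fun i _ => (ha i).mul
    (Complex.continuous_conj.comp (continuous_finsetSum _ fun j _ => (ha j).mul ?_)))
  exact P.continuous_inner01_delbar (hF j) (hF i)

variable {d : ℕ} {ψ : Fin d → M → ℂ}

/-- For a family of functions, `∂̄_b Σ |ψ_j|²` is the sum of `Σ ψ̄_j ∂̄_b ψ_j` and the conjugate of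
`Σ ψ̄_j ∂_b ψ_j`. -/
theorem delbar_sum_mul_conj (hψ : ∀ j, SmoothFun n (ψ j)) (x : M) :
    P.delbar (fun y => ∑ j, ψ j y * conj (ψ j y)) x =
      ∑ j, conj (ψ j x) • P.delbar (ψ j) x +
        ∑ j, ψ j x • P.delbar (fun y => conj (ψ j y)) x := by
  rw [P.delbar_sum _ fun j => (hψ j).mul (hψ j).conj, ← Finset.sum_add_distrib]
  exact Finset.sum_congr rfl fun j _ => 
    (P.delbar_mul (hψ j) (hψ j).conj x).trans (add_comm _ _)

theorem normSq10_sum_conj_smul_del (hψ : ∀ j, SmoothFun n (ψ j)) (x : M) :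
    P.normSq10 (∑ j, conj (ψ j x) • P.del (ψ j) x) =
      P.normSq01 (∑ j, ψ j x • P.delbar (fun y => conj (ψ j y)) x) := by
  refine P.normSq10_eq_normSq01 _ _ fun Z => ?_
  simp only [LinearMap.sum_apply, LinearMap.smul_apply, smul_eq_mul, map_sum, map_mul,
    Complex.conj_conj, P.delbar_conj_bar (hψ _)]

variable [T2Space M] [CompactSpace M] [MeasurableSpace M] [BorelSpace M]

theorem integrable_of_continuous {E : Type*} [NormedAddCommGroup E] {F : M → E}
    (hF : Continuous F) : Integrable F P.θ.vol :=
  hF.integrable_of_hasCompactSupport (HasCompactSupport.of_compactSpace F)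

/-- The weak form of the eigenvalue equation, tested against `ψ_j h` with `h` real and summed over
`j`. -/
theorem integral_weak_eigenvalue_equation {lam : ℝ} (hψ : ∀ j, ψ j ∈ P.eigenspace lam)
    {h : M → ℝ} (hh : SmoothFun n fun x => (h x : ℂ)) :
    ∫ x, (lam * h x * ∑ j, ‖ψ j x‖ ^ 2 - h x * ∑ j, P.normSq01 (P.delbar (ψ j) x) -
      (P.inner01 (∑ j, conj (ψ j x) • P.delbar (ψ j) x)
        (P.delbar (fun y => (h y : ℂ)) x)).re) ∂P.θ.vol = 0 := by
  let F : Fin d → M → ℂ := fun j x => (lam : ℂ) * ψ j x * conj (ψ j x * (h x : ℂ)) -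
    P.inner01 (P.delbar (ψ j) x) (P.delbar (fun y => ψ j y * (h y : ℂ)) x)
  have hsm (j) : SmoothFun n (ψ j) := (hψ j).1
  have hc1 (j) : Continuous fun x => (lam : ℂ) * ψ j x * conj (ψ j x * (h x : ℂ)) :=
    (continuous_const.mul (hsm j).continuous).mul ((hsm j).mul hh).conj.continuous
  have hc2 (j) : Continuous fun x =>
      P.inner01 (P.delbar (ψ j) x) (P.delbar (fun y => ψ j y * (h y : ℂ)) x) :=
    P.continuous_inner01_delbar (hsm j) ((hsm j).mul hh)
  have hF (j) : ∫ x, F j x ∂P.θ.vol = 0 := by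
    simp only [F]
    rw [integral_sub (P.integrable_of_continuous (hc1 j)) (P.integrable_of_continuous (hc2 j)),
      sub_eq_zero]
    exact (hψ j).2.2 _ ((hsm j).mul hh)
  have hFi (j) : Integrable (F j) P.θ.vol := P.integrable_of_continuous ((hc1 j).sub (hc2 j))
  have hsum : ∫ x, (∑ j, F j x).re ∂P.θ.vol = 0 := by
    have h1 := integral_re (𝕜 := ℂ) (integrable_finsetSum Finset.univ fun j _ => hFi j)
    rw [integral_finsetSum _ fun j _ => hFi j] at h1
    simpa [hF] using h1
  rw [← hsum]
  congr 1
  ext x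
  have hterm (j) : F j x = ((lam * h x * ‖ψ j x‖ ^ 2 - h x * P.normSq01 (P.delbar (ψ j) x) : ℝ) : ℂ)
      - P.inner01 (conj (ψ j x) • P.delbar (ψ j) x) (P.delbar (fun y => (h y : ℂ)) x) := by
    have hn : ψ j x * conj (ψ j x) = ((‖ψ j x‖ ^ 2 : ℝ) : ℂ) := by
      rw [Complex.mul_conj, Complex.normSq_eq_norm_sq]
    simp only [F]
    rw [P.delbar_mul (hsm j) hh, inner01_add_right, inner01_smul_right, inner01_smul_right,
      inner01_smul_left, inner01_self, map_mul, Complex.conj_ofReal]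
    push_cast at hn ⊢
    linear_combination (lam : ℂ) * h x * hn
  simp only [hterm, Finset.sum_sub_distrib, ← P.inner01_sum_left, Complex.sub_re,
    ← Complex.ofReal_sum, Complex.ofReal_re, Finset.mul_sum]

/-- Under the pointwise constraint and the integral inequality, `Σ |ψ_j|²` is equal to one. -/
theorem sum_norm_sq_eq_one {lam : ℝ} (hlam : 0 < lam) (hψ : ∀ j, ψ j ∈ P.eigenspace lam)
    (hcri : ∀ x, ∑ j, (((n : ℝ) + 1) * lam * ‖ψ j x‖ ^ 2
      - (n : ℝ) * P.normSq01 (P.delbar (ψ j) x)) = lam)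
    (hwird : ∫ x, P.normSq10 (∑ j, conj (ψ j x) • P.del (ψ j) x) ∂P.θ.vol
      ≤ ∫ x, P.normSq01 (∑ j, conj (ψ j x) • P.delbar (ψ j) x) ∂P.θ.vol) (x : M) :
    ∑ j, ‖ψ j x‖ ^ 2 = 1 := by
  have hsm (j) : SmoothFun n (ψ j) := (hψ j).1
  let r : M → ℝ := fun x => ∑ j, ‖ψ j x‖ ^ 2
  have hr (x : M) : ∑ j, ψ j x * conj (ψ j x) = (r x : ℂ) := by
    simp only [r, Complex.mul_conj, Complex.normSq_eq_norm_sq, Complex.ofReal_sum]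
  have hrsm : SmoothFun n fun x => ∑ j, ψ j x * conj (ψ j x) :=
    SmoothFun.sum fun j => (hsm j).mul (hsm j).conj
  have hrc : Continuous r :=
    continuous_finsetSum _ fun j _ => (hsm j).continuous.norm.pow 2
  have hh : (fun x => ((r x - 1 : ℝ) : ℂ)) = fun x => ∑ j, ψ j x * conj (ψ j x) + (-1) := by
    ext x
    rw [hr]
    push_cast
    ring
  have hhsm : SmoothFun n fun x => ((r x - 1 : ℝ) : ℂ) := by
    rw [hh]
    exact hrsm.add (SmoothFun.const (-1))
  let σ : ∀ x, Module.Dual ℂ (P.T01 x) := fun x => ∑ j, conj (ψ j x) • P.delbar (ψ j) x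
  let τ : ∀ x, Module.Dual ℂ (P.T01 x) := fun x =>
    ∑ j, ψ j x • P.delbar (fun y => conj (ψ j y)) x
  have hdelbar (x : M) : P.delbar (fun y => ((r y - 1 : ℝ) : ℂ)) x = σ x + τ x := by
    rw [hh, P.delbar_add_const hrsm, P.delbar_sum_mul_conj hsm]
  have hσc : Continuous fun x => P.normSq01 (σ x) :=
    P.continuous_normSq01_sum _ (fun j => (hsm j).conj.continuous) hsm
  have hτc : Continuous fun x => P.normSq01 (τ x) :=
    P.continuous_normSq01_sum _ (fun j => (hsm j).continuous) fun j => (hsm j).conj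
  have hστc : Continuous fun x => P.normSq01 (σ x + τ x) := by
    simp only [← hdelbar]
    exact Complex.continuous_re.comp (P.continuous_inner01_delbar hhsm hhsm)
  have hτσ : ∫ x, P.normSq01 (τ x) ∂P.θ.vol ≤ ∫ x, P.normSq01 (σ x) ∂P.θ.vol := by
    simpa only [P.normSq10_sum_conj_smul_del hsm] using hwird
  -- The pointwise constraint eliminates `Σ |∂̄_b ψ_j|²`.
  have hpt (x : M) : (n : ℝ) * (lam * (r x - 1) * ∑ j, ‖ψ j x‖ ^ 2 -
      (r x - 1) * ∑ j, P.normSq01 (P.delbar (ψ j) x) -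
      (P.inner01 (σ x) (P.delbar (fun y => ((r y - 1 : ℝ) : ℂ)) x)).re) =
      -(lam * (r x - 1) ^ 2 + n / 2 *
        (P.normSq01 (σ x) - P.normSq01 (τ x) + P.normSq01 (σ x + τ x))) := by
    have h1 := hcri x
    rw [Finset.sum_sub_distrib, ← Finset.mul_sum, ← Finset.mul_sum] at h1
    rw [hdelbar, P.re_inner01_add]
    change (n : ℝ) * (lam * (r x - 1) * r x - _ - _) = _
    change ((n : ℝ) + 1) * lam * r x - _ = lam at h1
    linear_combination (r x - 1) * h1
  have hzero := congrArg (fun t : ℝ => (n : ℝ) * t)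
    (P.integral_weak_eigenvalue_equation hψ hhsm)
  simp only [mul_zero] at hzero
  rw [← integral_const_mul] at hzero
  have hAc : Continuous fun x => lam * (r x - 1) ^ 2 :=
    continuous_const.mul ((hrc.sub continuous_const).pow 2)
  have hAi := P.integrable_of_continuous hAc
  have hσi := P.integrable_of_continuous hσc
  have hτi := P.integrable_of_continuous hτc
  have hστi := P.integrable_of_continuous hστc
  have hdi : Integrable (fun x => P.normSq01 (σ x) - P.normSq01 (τ x)) P.θ.vol := hσi.sub hτi
  have hsi : Integrable (fun x => n / 2 *
      (P.normSq01 (σ x) - P.normSq01 (τ x) + P.normSq01 (σ x + τ x))) P.θ.vol :=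
    (hdi.add hστi).const_mul _
  have hint : ∫ x, lam * (r x - 1) ^ 2 ∂P.θ.vol + n / 2 * (∫ x, P.normSq01 (σ x) ∂P.θ.vol -
      ∫ x, P.normSq01 (τ x) ∂P.θ.vol + ∫ x, P.normSq01 (σ x + τ x) ∂P.θ.vol) = 0 := by
    rw [← integral_sub hσi hτi, ← integral_add hdi hστi, ← integral_const_mul,
      ← integral_add hAi hsi, ← neg_eq_zero, ← integral_neg, ← hzero]
    exact integral_congr_ae (Filter.Eventually.of_forall fun x => (hpt x).symm)
  have hAnonneg : ∀ x, 0 ≤ lam * (r x - 1) ^ 2 := fun x =>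
    mul_nonneg hlam.le (sq_nonneg _)
  have hστnonneg : 0 ≤ ∫ x, P.normSq01 (σ x + τ x) ∂P.θ.vol :=
    integral_nonneg fun x => P.normSq01_nonneg _
  have hA0 : ∫ x, lam * (r x - 1) ^ 2 ∂P.θ.vol = 0 := by
    refine le_antisymm ?_ (integral_nonneg hAnonneg)
    have : 0 ≤ (n : ℝ) / 2 * (∫ x, P.normSq01 (σ x) ∂P.θ.vol -
      ∫ x, P.normSq01 (τ x) ∂P.θ.vol + ∫ x, P.normSq01 (σ x + τ x) ∂P.θ.vol) :=
      mul_nonneg (by positivity) (by linarith)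
    linarith
  have hae := (integral_eq_zero_iff_of_nonneg hAnonneg hAi).1 hA0
  have hall := hAc.ae_eq_iff_eq P.θ.vol continuous_zero |>.1 hae
  have hx : lam * (r x - 1) ^ 2 = 0 := congrFun hall x
  have h1 := pow_eq_zero_iff two_ne_zero |>.1 ((mul_eq_zero.1 hx).resolve_left hlam.ne')
  exact sub_eq_zero.1 h1
end PseudohermitianStructure

end

theorem mainTheorem10 {n : ℕ} (hn : 1 ≤ n) {M : Type*} [TopologicalSpace M] [T2Space M]
    [CompactSpace M] [ChartedSpace (CRModel n) M] [IsManifold (𝓡 (2 * n + 1)) ∞ M]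
    [MeasurableSpace M] [BorelSpace M] (P : PseudohermitianStructure n M)
    (k : ℕ) (lam : ℝ) (hlam : P.IsKthEigenvalue k lam)
    {d : ℕ} (ψ : Fin d → M → ℂ) (hψ : ∀ j, ψ j ∈ P.eigenspace lam)
    (hcri : ∀ x, ∑ j, (((n : ℝ) + 1) * lam * ‖ψ j x‖ ^ 2
      - (n : ℝ) * P.normSq01 (P.delbar (ψ j) x)) = lam)
    (hwird : ∫ x, P.normSq10 (∑ j, conj (ψ j x) • P.del (ψ j) x) ∂P.θ.vol
      ≤ ∫ x, P.normSq01 (∑ j, conj (ψ j x) • P.delbar (ψ j) x) ∂P.θ.vol) :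
    ∃ c : ℝ, ∀ x, ∑ j, ‖ψ j x‖ ^ 2 = c := by
  exact ⟨1, P.sum_norm_sq_eq_one hlam.1 hψ hcri hwird⟩
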